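/- **Function spaces.** Let $N\ge 0$ be an integer, $\alpha\in(0,1]$, $p\ge 0$. For $f:\mathbb R\to\mathbb R$ put $$\|f\|_{\alpha,p}=\sup_{x\ne y}\frac{|f(x)-f(y)|}{|x-y|^{\alpha}(1+|x|^p+|y|^p)} .$$ Let $\mathcal H^N_{\alpha,p}$ be the set of Borel functions $h:\mathbb R\to\mathbb R$ having an $N$-th derivative $h^{(N)}$ (for $N\ge1$: $h\in C^{N-1}$ and $h^{(N-1)}$ is a primitive of $h^{(N)}$) which is locally of finite variation with finitely many jumps and whose continuous part $h^{(N)}_c$ satisfies $\|h^{(N)}_c\|_{\alpha,p}<\infty$. Here $g_c$ is the continuous function, locally of finite variation and vanishing at $0$, such that $g-g_c$ is a pure jump function. Below, $f^{(k)}$ is the $k$-th iterated derivative; at the finitely many points where a derivative fails to exist its value is fixed by an arbitrary convention, chosen once and for all for each function. **Random variables.** Let $n\ge1$ and let $X_1,\dots,X_n$ be independent real random variables with $\mathbb E[X_i]=0$, $\sigma_i^2=\mathrm{Var}(X_i)>0$ and $\mathbb E|X_i|^{N+\max(\alpha+p,2)}<\infty$. Put $W=X_1+\dots+X_n$, $W^{(i)}=W-X_i$,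 $\sigma_W^2=\mathrm{Var}(W)$. Let $X_i^*$ be a random variable independent of $W^{(i)}$ with the zero biased distribution of $X_i$, i.e. $\mathbb E[X_if(X_i)]=\sigma_i^2\,\mathbb E[f'(X_i^*)]$ for every differentiable $f$ for which both expectations are well defined. **Notation.** Let $\phi_\sigma$ be the density of $N(0,\sigma^2)$, $\Phi_\sigma(h)=\int h\,\phi_\sigma$, and, with $\sigma=\sigma_W$, $$f_h(x)=\frac{1}{\sigma^2\phi_\sigma(x)}\int_x^\infty (h(t)-\Phi_\sigma(h))\phi_\sigma(t)\,dt .$$ Let $m_Y^{(k)}=\mathbb E[Y^k]/k!$ and, for $\mathbf J=(j_1,\dots,j_d)$ with positive integer entries, $|\mathbf J|=j_1+\dots+j_d$ and $m_Y^{(\mathbf J)}=m_Y^{(j_1)}\cdots m_Y^{(j_d)}$ (for $d=0$: $|\emptyset|=0$, $m_Y^{(\emptyset)}=1$). For $d\ge1$, $\mathbf J^\dagger$ is the last coordinate of $\mathbf J$ and $\mathbf J^\circ$ is $\mathbf J$ with the last coordinate omitted. For independent $X,Y$ put $$\delta_N(f,X,Y)=\mathbb E[f(X+Y)]-\sum_{k=0}^N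 m_Y^{(k)}\,\mathbb E[f^{(k)}(X)],$$ $$\varepsilon_N(f,X,Y)=-\sum_{d\ge0}(-1)^d\sum_{\mathbf J\in\mathbb N_*^d,\ |\mathbf J|\le N} m_Y^{(\mathbf J)}\,\delta_{N-|\mathbf J|}(f^{(|\mathbf J|)},X,Y).$$ Define $C_0(h)=\Phi_{\sigma_W}(h)$, $e_0(h)=\mathbb E[h(W)]-\Phi_{\sigma_W}(h)$ and, recursively for $N\ge1$, $$C_N(h)=C_0(h)+\sum_{i=1}^n\sigma_i^2\sum_{d\ge1}(-1)^{d-1}\sum_{\mathbf J\in\mathbb N_*^d,\ |\mathbf J|\le N} m_{X_i}^{(\mathbf J^\circ)}\big(m_{X_i^*}^{(\mathbf J^\dagger)}-m_{X_i}^{(\mathbf J^\dagger)}\big)\,C_{N-|\mathbf J|}\big(f_h^{(|\mathbf J|+1)}\big),$$ $$e_N(h)=\sum_{i=1}^n\sigma_i^2\Big[\sum_{d\ge1}(-1)^{d-1}\sum_{\mathbf J\in\mathbb N_*^d,\ |\mathbf J|\le N} m_{X_i}^{(\mathbf J^\circ)}\big(m_{X_i^*}^{(\mathbf J^\dagger)}-m_{X_i}^{(\mathbf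 J^\dagger)}\big)\,e_{N-|\mathbf J|}\big(f_h^{(|\mathbf J|+1)}\big)+\sum_{k=0}^N\varepsilon_{N-k}\big(f_h^{(k+1)},W^{(i)},X_i\big)\,m_{X_i^*}^{(k)}+\delta_N\big(f_h',W^{(i)},X_i^*\big)\Big].$$ **Theorem.** Let $h\in\mathcal H^N_{\alpha,p}$, and let $X_1,\dots,X_n$ be as above. Then each $X_i$ has a unique zero biased distribution; all the terms in the recursive formulas for $C_N(h)$ and $e_N(h)$ are well defined, at every level of the recursion (the functions $f_g$ and their derivatives of the orders that occur exist, and all the expectations that occur are absolutely convergent); $h(W)$ is integrable; and $$\mathbb E[h(W)]=C_N(h)+e_N(h).$$ -/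

import Mathlib

open MeasureTheory ProbabilityTheory

/-! ### The function spaces -/

/-- `F` is a primitive of the locally integrable function `f`. -/
def IsPrimitive (F f : ℝ → ℝ) : Prop :=
  (∀ a b : ℝ, IntervalIntegrable f volume a b) ∧ ∀ x : ℝ, F x = F 0 + ∫ t in (0 : ℝ)..x, f t

/-- `g` is (a version of) the derivative of order `N` of `h`: `h` is obtained from `g` by taking
primitives `N` times. Since primitives are continuous, for `N ≥ 1` this makes `h` of class
`C^(N-1)` with `h^(N-1)` a primitive of `g`. -/
def IsNthDerivative : ℕ → (ℝ → ℝ) → (ℝ → ℝ) → Prop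
  | 0, h, g => g = h
  | N + 1, h, g => ∃ h' : ℝ → ℝ, IsPrimitive h h' ∧ IsNthDerivative N h' g

/-- The quantity `‖f‖_{α,p} = sup_{x ≠ y} |f x - f y| / (|x - y|^α (1 + |x|^p + |y|^p))`,
as an element of `[0, ∞]`. -/
noncomputable def alphaPNorm (α p : ℝ) (f : ℝ → ℝ) : ENNReal :=
  ⨆ (x : ℝ) (y : ℝ) (_ : x ≠ y),
    ENNReal.ofReal (|f x - f y| / (|x - y| ^ α * (1 + |x| ^ p + |y| ^ p)))

/-- A pure jump function with finitely many jumps: constant on every interval that avoids a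
certain finite set. -/
def IsPureJump (g : ℝ → ℝ) : Prop :=
  ∃ S : Finset ℝ, ∀ x y : ℝ, x ≤ y → (∀ s ∈ S, s ∉ Set.Icc x y) → g x = g y

/-- `gc` is the continuous part of `g` (`g` being locally of finite variation with finitely many
jumps): `gc` is continuous, locally of finite variation, vanishes at the origin, and
`g - gc` is a pure jump function. These conditions determine `gc`. -/
def IsContinuousPart (g gc : ℝ → ℝ) : Prop :=
  Continuous gc ∧ LocallyBoundedVariationOn gc Set.univ ∧ gc 0 = 0 ∧
    IsPureJump (fun x => g x - gc x)

/-- The space `H^N_{α,p}`: Borel functions whose derivative of order `N` is locally of finite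
variation with finitely many jumps, and has a continuous part of finite `‖·‖_{α,p}`. -/
def MemH (N : ℕ) (α p : ℝ) (h : ℝ → ℝ) : Prop :=
  Measurable h ∧ ∃ g : ℝ → ℝ, IsNthDerivative N h g ∧
    LocallyBoundedVariationOn g Set.univ ∧
    {x : ℝ | ¬ ContinuousAt g x}.Finite ∧
    ∃ gc : ℝ → ℝ, IsContinuousPart g gc ∧ alphaPNorm α p gc < ⊤

/-- `D` is a convention for the derivative: `D f` is the usual derivative of `f` wherever it
exists, and takes some prescribed values at the other points. -/
def IsDerivativeConvention (D : (ℝ → ℝ) → ℝ → ℝ) : Prop :=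
  ∀ (f : ℝ → ℝ) (x : ℝ), DifferentiableAt ℝ f x → D f x = deriv f x

/-- The iterated derivatives `f^(k) = D^[k] f` up to order `N + 1` exist: `f^(k)` is
differentiable for `k < N`, and `f^(N)` is differentiable outside a finite set and is a primitive
of its derivative. -/
def DerivativesExist (D : (ℝ → ℝ) → ℝ → ℝ) (N : ℕ) (f : ℝ → ℝ) : Prop :=
  (∀ k < N, Differentiable ℝ (D^[k] f)) ∧
    {x : ℝ | ¬ DifferentiableAt ℝ (D^[N] f) x}.Finite ∧
    IsPrimitive (D^[N] f) (D^[N + 1] f)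

/-! ### Normal expectation and the solution of Stein's equation (`v` is the variance) -/

/-- `Φ_σ(h)`, the expectation of `h` under `N(0, v)`, `v = σ²`. -/
noncomputable def normalExp (v : NNReal) (h : ℝ → ℝ) : ℝ :=
  ∫ x, h x ∂(gaussianReal 0 v)

/-- `f_h(x) = (σ² φ_σ(x))⁻¹ ∫_x^∞ (h(t) - Φ_σ(h)) φ_σ(t) dt`, with `v = σ²`. -/
noncomputable def steinSol (v : NNReal) (h : ℝ → ℝ) (x : ℝ) : ℝ :=
  1 / ((v : ℝ) * gaussianPDFReal 0 v x) *
    ∫ t in Set.Ioi x, (h t - normalExp v h) * gaussianPDFReal 0 v t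

/-- `Φ_σ(h)` and the integrals defining `f_h` converge. -/
def SteinSolWellDefined (v : NNReal) (h : ℝ → ℝ) : Prop :=
  Integrable h (gaussianReal 0 v) ∧
    ∀ x : ℝ, IntegrableOn (fun t => (h t - normalExp v h) * gaussianPDFReal 0 v t) (Set.Ioi x)

/-! ### Zero bias -/

/-- The law `ν` is a zero biased distribution of the law `μ`:
`E[X f(X)] = σ² E[f'(X*)]` with `X ∼ μ`, `X* ∼ ν`, `σ² = Var X`, for every differentiable `f`
for which both expectations are well defined. -/
def IsZeroBias (μ ν : Measure ℝ) : Prop :=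
  ∀ f : ℝ → ℝ, Differentiable ℝ f → Integrable (fun x => x * f x) μ → Integrable (deriv f) ν →
    ∫ x, x * f x ∂μ = variance (fun x : ℝ => x) μ * ∫ x, deriv f x ∂ν

/-! ### Moments, Taylor remainder, reverse Taylor remainder

A multi-index `J ∈ (ℕ_{>0})^d` with `|J| = s` is a composition `c : Composition s` with
`c.length = d` (and entries `c.blocks`); for `s = 0` there is only the empty one. -/

section Remainders

variable {Ω : Type*} [MeasurableSpace Ω]

/-- `m_Y^(k) = E[Y^k] / k!`. -/
noncomputable def normMoment (P : Measure Ω) (Y : Ω → ℝ) (k : ℕ) : ℝ :=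
  (∫ ω, Y ω ^ k ∂P) / (Nat.factorial k : ℝ)

/-- `m_Y^(J) = m_Y^(j_1) ⋯ m_Y^(j_d)`, equal to `1` for the empty multi-index. -/
noncomputable def multiMoment (P : Measure Ω) (Y : Ω → ℝ) (J : List ℕ) : ℝ :=
  (J.map (normMoment P Y)).prod

/-- `δ_N(f,X,Y) = E[f(X+Y)] - ∑_{k=0}^N m_Y^(k) E[f^(k)(X)]`. -/
noncomputable def taylorRem (D : (ℝ → ℝ) → ℝ → ℝ) (P : Measure Ω) (N : ℕ) (f : ℝ → ℝ)
    (X Y : Ω → ℝ) : ℝ :=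
  ∫ ω, f (X ω + Y ω) ∂P -
    ∑ k ∈ Finset.range (N + 1), normMoment P Y k * ∫ ω, (D^[k] f) (X ω) ∂P

/-- All the expectations in `δ_N(f,X,Y)` are well defined. -/
def TaylorRemWellDefined (D : (ℝ → ℝ) → ℝ → ℝ) (P : Measure Ω) (N : ℕ) (f : ℝ → ℝ)
    (X Y : Ω → ℝ) : Prop :=
  Integrable (fun ω => f (X ω + Y ω)) P ∧
    ∀ k ≤ N, Integrable (fun ω => Y ω ^ k) P ∧ Integrable (fun ω => (D^[k] f) (X ω)) P

/-- `ε_N(f,X,Y) = - ∑_d (-1)^d ∑_{J ∈ (ℕ_{>0})^d, |J| ≤ N} m_Y^(J) δ_{N-|J|}(f^(|J|),X,Y)`. -/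
noncomputable def revTaylorRem (D : (ℝ → ℝ) → ℝ → ℝ) (P : Measure Ω) (N : ℕ) (f : ℝ → ℝ)
    (X Y : Ω → ℝ) : ℝ :=
  - ∑ s ∈ Finset.range (N + 1), ∑ c : Composition s,
      (-1 : ℝ) ^ c.length * multiMoment P Y c.blocks * taylorRem D P (N - s) (D^[s] f) X Y

/-- All the expectations in `ε_N(f,X,Y)` are well defined. -/
def RevTaylorRemWellDefined (D : (ℝ → ℝ) → ℝ → ℝ) (P : Measure Ω) (N : ℕ) (f : ℝ → ℝ)
    (X Y : Ω → ℝ) : Prop :=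
  ∀ s ≤ N, Integrable (fun ω => Y ω ^ s) P ∧ TaylorRemWellDefined D P (N - s) (D^[s] f) X Y

end Remainders

/-! ### The recursive expansion -/

section Expansion

variable {Ω : Type*} [MeasurableSpace Ω] {n : ℕ}

/-- `W = X_1 + ⋯ + X_n`. -/
def sumW (X : Fin n → Ω → ℝ) (ω : Ω) : ℝ := ∑ i, X i ω

/-- `W^(i) = W - X_i`. -/
def sumWithout (X : Fin n → Ω → ℝ) (i : Fin n) (ω : Ω) : ℝ := sumW X ω - X i ω

/-- `σ_W² = Var W`. -/
noncomputable def varW (P : Measure Ω) (X : Fin n → Ω → ℝ) : NNReal :=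
  (variance (sumW X) P).toNNReal

/-- `(-1)^(d-1) m_{X_i}^(J°) (m_{X_i*}^(J†) - m_{X_i}^(J†))` for a nonempty multi-index `J` of
length `d`, where `J†` is the last coordinate of `J` and `J°` is `J` without it.
Here `Y` is `X_i` and `Ys` is `X_i*`. -/
noncomputable def expansionCoeff (P : Measure Ω) (Y Ys : Ω → ℝ) (J : List ℕ) : ℝ :=
  (-1 : ℝ) ^ (J.length - 1) * multiMoment P Y J.dropLast *
    (normMoment P Ys (J.getLastD 0) - normMoment P Y (J.getLastD 0))

/-- The main term `C_N(h)`; `X i` is `X_i` and `Xs i` is `X_i*`. -/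
noncomputable def mainTerm (D : (ℝ → ℝ) → ℝ → ℝ) (P : Measure Ω) (X Xs : Fin n → Ω → ℝ) :
    ℕ → (ℝ → ℝ) → ℝ
  | 0, h => normalExp (varW P X) h
  | N + 1, h => normalExp (varW P X) h +
      ∑ i, variance (X i) P *
        ∑ s ∈ (Finset.Icc 1 (N + 1)).attach, ∑ c : Composition s.1,
          expansionCoeff P (X i) (Xs i) c.blocks *
            mainTerm D P X Xs (N + 1 - s.1) (D^[s.1 + 1] (steinSol (varW P X) h))
  termination_by N _ => N
  decreasing_by
    have := (Finset.mem_Icc.mp s.2).1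
    omega

/-- The error term `e_N(h)`. -/
noncomputable def errorTerm (D : (ℝ → ℝ) → ℝ → ℝ) (P : Measure Ω) (X Xs : Fin n → Ω → ℝ) :
    ℕ → (ℝ → ℝ) → ℝ
  | 0, h => ∫ ω, h (sumW X ω) ∂P - normalExp (varW P X) h
  | N + 1, h =>
      ∑ i, variance (X i) P *
        ((∑ s ∈ (Finset.Icc 1 (N + 1)).attach, ∑ c : Composition s.1,
            expansionCoeff P (X i) (Xs i) c.blocks *
              errorTerm D P X Xs (N + 1 - s.1) (D^[s.1 + 1] (steinSol (varW P X) h)))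
          + ∑ k ∈ Finset.range (N + 2),
              revTaylorRem D P (N + 1 - k) (D^[k + 1] (steinSol (varW P X) h))
                (sumWithout X i) (X i) * normMoment P (Xs i) k
          + taylorRem D P (N + 1) (D (steinSol (varW P X) h)) (sumWithout X i) (Xs i))
  termination_by N _ => N
  decreasing_by
    have := (Finset.mem_Icc.mp s.2).1
    omega

/-- All the terms in the recursive formula for `C_N(h)` are well defined. -/
def MainTermWellDefined (D : (ℝ → ℝ) → ℝ → ℝ) (P : Measure Ω) (X Xs : Fin n → Ω → ℝ) :
    ℕ → (ℝ → ℝ) → Prop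
  | 0, h => Integrable h (gaussianReal 0 (varW P X))
  | N + 1, h =>
      SteinSolWellDefined (varW P X) h ∧
      DerivativesExist D (N + 1) (steinSol (varW P X) h) ∧
      (∀ i, ∀ k ≤ N + 1,
        Integrable (fun ω => X i ω ^ k) P ∧ Integrable (fun ω => Xs i ω ^ k) P) ∧
      ∀ s, 1 ≤ s → s ≤ N + 1 →
        MainTermWellDefined D P X Xs (N + 1 - s) (D^[s + 1] (steinSol (varW P X) h))
  termination_by N _ => N

/-- All the terms in the recursive formula for `e_N(h)` are well defined. -/
def ErrorTermWellDefined (D : (ℝ → ℝ) → ℝ → ℝ) (P : Measure Ω) (X Xs : Fin n → Ω → ℝ) :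
    ℕ → (ℝ → ℝ) → Prop
  | 0, h => Integrable (fun ω => h (sumW X ω)) P ∧ Integrable h (gaussianReal 0 (varW P X))
  | N + 1, h =>
      SteinSolWellDefined (varW P X) h ∧
      DerivativesExist D (N + 1) (steinSol (varW P X) h) ∧
      (∀ i, ∀ k ≤ N + 1,
        Integrable (fun ω => X i ω ^ k) P ∧ Integrable (fun ω => Xs i ω ^ k) P) ∧
      (∀ s, 1 ≤ s → s ≤ N + 1 →
        ErrorTermWellDefined D P X Xs (N + 1 - s) (D^[s + 1] (steinSol (varW P X) h))) ∧
      (∀ i, ∀ k ≤ N + 1,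
        RevTaylorRemWellDefined D P (N + 1 - k) (D^[k + 1] (steinSol (varW P X) h))
          (sumWithout X i) (X i)) ∧
      ∀ i, TaylorRemWellDefined D P (N + 1) (D (steinSol (varW P X) h))
        (sumWithout X i) (Xs i)
  termination_by N _ => N

end Expansion

/-! For `f = f_h`, Stein's equation reads `x f - σ² f' = h - Φ_σ(h)`. Evaluate it at `W`, write `W
f(W)` as the sum of the `X_i f(W^(i) + X_i)`, and apply zero bias to each term with `W^(i)` frozen.
Since `σ²` is the sum of the `σ_i²`, this gives `E[h(W)] - Φ_σ(h) = ∑ σ_i² (E[f'(W^(i) + X_i*)] -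
E[f'(W)])`; this is `SteinRegular.integral_sub_eq_sum`.

Each difference is then expanded by algebra alone (`integral_sub_integral_eq_expansion`): a Taylor
expansion in `X_i*` around `W^(i)`, followed by a reverse Taylor expansion from `W^(i)` back to `W`.
The remainders `δ` and `ε` are defined as differences, so the identity is exact and nothing is
estimated. The sums of `(-1)^d m^(J)` over `|J| = s` are the coefficients of the reciprocal of the
formal series `∑ m^(k) t^k`. Hence the coefficient of `E[f^(s+1)(W)]` is the `s`-th coefficient of
the moment series of `X_i*` divided by that of `X_i`. The values of derivatives at exceptional
points cancel, the same convention being used throughout. The induction hypothesis for `f^(s+1)` at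
order `N - s` concludes.

The analysis serves to keep the recursion inside one class and to make everything integrable. The
regularity in the definition of `H^N_{α,p}` is relaxed to `FiniteOrderClass N q` with `q = α + p`:
finitely many discontinuities and growth `q` of the `N`-th derivative. For `k ≥ 1`, `f^(k)` solves a
Stein equation with right-hand side `h^(k) - k f^(k-1)`, and a solution negligible against the
inverse Gaussian weight gains one power over its right-hand side (`PolyGrowth.of_stein`). So `f^(k)`
has growth `N - k + q - 1` for `k ≤ N`, and `f^(N+1)` has growth `q`; thus `f^(s+1)` belongs to the
class of order `N - s` with the same `q`. Moments match: with `M = N + max q 2`, zero bias loses two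
moments, and `f'` grows only like the power `N + q - 2`. -/

/-! ### Algebra of the Taylor and reverse Taylor expansions -/

/-- Sums over the compositions of `s > 0` can be split according to the last block. -/
theorem sum_composition_concat {s : ℕ} (hs : 0 < s) (F : List ℕ → ℝ) :
    ∑ c : Composition s, F c.blocks =
      ∑ k ∈ Finset.Icc 1 s, ∑ c : Composition (s - k), F (c.blocks ++ [k]) := by
  rw [Finset.sum_sigma']
  have hne (c : Composition s) : c.blocks ≠ [] := by
    intro h
    have := c.blocks_sum
    simp [h] at this
    omega
  have hsum (c : Composition s) : c.blocks.dropLast.sum + c.blocks.getLast (hne c) = s := by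
    conv_rhs => rw [← c.blocks_sum, ← List.dropLast_append_getLast (hne c)]
    simp
  refine Finset.sum_bij'
    (i := fun c _ => ⟨c.blocks.getLast (hne c),
      ⟨c.blocks.dropLast, fun h => c.blocks_pos (List.mem_of_mem_dropLast h), by
        have := hsum c; omega⟩⟩)
    (j := fun q hq => ⟨q.2.blocks ++ [q.1], fun {i} hi => by
        have h1 := (Finset.mem_Icc.mp (Finset.mem_sigma.mp hq).1).1
        rcases List.mem_append.mp hi with h | h
        · exact q.2.blocks_pos h
        · rw [List.mem_singleton.mp h]; omega, by
        have h1 := (Finset.mem_Icc.mp (Finset.mem_sigma.mp hq).1).2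
        simp only [List.sum_append, q.2.blocks_sum, List.sum_singleton]
        omega⟩) ?_ ?_ ?_ ?_ ?_
  · intro c _
    simp only [Finset.mem_sigma, Finset.mem_Icc, Finset.mem_univ, and_true]
    have := hsum c
    have h1 : 0 < c.blocks.getLast (hne c) := c.blocks_pos (List.getLast_mem _)
    omega
  · intro q _; exact Finset.mem_univ _
  · intro c _
    ext1
    exact List.dropLast_append_getLast (hne c)
  · rintro ⟨k, c⟩ hq
    have hk := Finset.mem_Icc.mp (Finset.mem_sigma.mp hq).1
    refine Sigma.ext (by simp) ?_
    obtain ⟨b, hb, hb'⟩ := c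
    simp only [List.dropLast_concat]
    congr!
  · intro c _
    exact congrArg F (List.dropLast_append_getLast (hne c)).symm

section

variable {Ω : Type*} [MeasurableSpace Ω]

/-- The coefficients `∑_{|J| = s} (-1)^d m_Y^(J)` of the reverse Taylor expansion. -/
noncomputable def revCoeff (P : Measure Ω) (Y : Ω → ℝ) (s : ℕ) : ℝ :=
  ∑ c : Composition s, (-1 : ℝ) ^ c.length * multiMoment P Y c.blocks

theorem normMoment_zero (P : Measure Ω) [IsProbabilityMeasure P] (Y : Ω → ℝ) :
    normMoment P Y 0 = 1 := by simp [normMoment]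

theorem revCoeff_zero (P : Measure Ω) (Y : Ω → ℝ) : revCoeff P Y 0 = 1 := by
  have h (c : Composition 0) : (-1 : ℝ) ^ c.length * multiMoment P Y c.blocks = 1 := by
    have : c.blocks = [] := by
      rw [← List.length_eq_zero_iff]
      have := c.length_le
      simp only [Composition.length] at this
      omega
    simp [Composition.length, this, multiMoment]
  simp [revCoeff, h, composition_card]

theorem revCoeff_of_pos (P : Measure Ω) (Y : Ω → ℝ) {s : ℕ} (hs : 0 < s) :
    revCoeff P Y s = -∑ k ∈ Finset.Icc 1 s, revCoeff P Y (s - k) * normMoment P Y k := by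
  rw [revCoeff, sum_composition_concat hs (fun b => (-1 : ℝ) ^ b.length * multiMoment P Y b),
    ← Finset.sum_neg_distrib]
  refine Finset.sum_congr rfl fun k _ => ?_
  rw [revCoeff, Finset.sum_mul, ← Finset.sum_neg_distrib]
  refine Finset.sum_congr rfl fun c _ => ?_
  simp [multiMoment, pow_succ, Composition.length]
  ring

theorem sum_expansionCoeff (P : Measure Ω) (Y Ys : Ω → ℝ) {s : ℕ} (hs : 0 < s) :
    ∑ c : Composition s, expansionCoeff P Y Ys c.blocks =
      ∑ k ∈ Finset.Icc 1 s, revCoeff P Y (s - k) * (normMoment P Ys k - normMoment P Y k) := by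
  rw [sum_composition_concat hs (expansionCoeff P Y Ys)]
  refine Finset.sum_congr rfl fun k _ => ?_
  rw [revCoeff, Finset.sum_mul]
  refine Finset.sum_congr rfl fun c _ => ?_
  simp [expansionCoeff, Composition.length]

theorem sum_range_succ_eq_add_Icc (f : ℕ → ℝ) (s : ℕ) :
    ∑ k ∈ Finset.range (s + 1), f k = f 0 + ∑ k ∈ Finset.Icc 1 s, f k := by
  rw [Finset.range_eq_Ico, Finset.sum_eq_sum_Ico_succ_bot (by omega)]
  rfl

/-- `revCoeff` is the reciprocal of the moment series: splitting off the last block of a composition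
gives the recursion that defines the reciprocal. -/
theorem sum_revCoeff_mul_normMoment (P : Measure Ω) [IsProbabilityMeasure P] (Y : Ω → ℝ) (s : ℕ) :
    ∑ k ∈ Finset.range (s + 1), revCoeff P Y (s - k) * normMoment P Y k =
      if s = 0 then 1 else 0 := by
  rcases Nat.eq_zero_or_pos s with rfl | hs
  · simp [revCoeff_zero, normMoment_zero]
  · rw [sum_range_succ_eq_add_Icc, if_neg hs.ne', Nat.sub_zero, normMoment_zero,
      revCoeff_of_pos P Y hs]
    ring

/-- For `s > 0` the part of the coefficient that involves only the moments of `Y` is, up to the term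
`k = 0`, the vanishing convolution of `sum_revCoeff_mul_normMoment`. What remains is the quotient of
the two moment series. -/
theorem sum_expansionCoeff_add (P : Measure Ω) [IsProbabilityMeasure P] (Y Ys : Ω → ℝ)
    {s : ℕ} (hs : 0 < s) :
    ∑ c : Composition s, expansionCoeff P Y Ys c.blocks =
      ∑ k ∈ Finset.range (s + 1), revCoeff P Y (s - k) * normMoment P Ys k := by
  have h := sum_revCoeff_mul_normMoment P Y s
  rw [if_neg hs.ne', sum_range_succ_eq_add_Icc, normMoment_zero] at h
  rw [sum_expansionCoeff P Y Ys hs, sum_range_succ_eq_add_Icc, normMoment_zero]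
  simp only [mul_sub, Finset.sum_sub_distrib]
  linarith

/-- Exchange of the two sums over a triangle `s + k ≤ N`. -/
theorem sum_triangle (N : ℕ) (f : ℕ → ℕ → ℝ) :
    ∑ s ∈ Finset.range (N + 1), ∑ k ∈ Finset.range (N - s + 1), f s k =
      ∑ j ∈ Finset.range (N + 1), ∑ k ∈ Finset.range (j + 1), f (j - k) k := by
  rw [Finset.sum_sigma', Finset.sum_sigma']
  refine Finset.sum_bij' (i := fun q _ => ⟨q.1 + q.2, q.2⟩) (j := fun q _ => ⟨q.1 - q.2, q.2⟩)
    ?_ ?_ ?_ ?_ ?_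
  · rintro ⟨a, b⟩ h
    simp only [Finset.mem_sigma, Finset.mem_range] at h ⊢
    omega
  · rintro ⟨a, b⟩ h
    simp only [Finset.mem_sigma, Finset.mem_range] at h ⊢
    omega
  · rintro ⟨a, b⟩ h
    simp
  · rintro ⟨a, b⟩ h
    simp only [Finset.mem_sigma, Finset.mem_range] at h
    simp only [Sigma.mk.injEq, heq_eq_eq, and_true]
    omega
  · rintro ⟨a, b⟩ h
    simp

/-- The reverse Taylor expansion. -/
theorem revTaylorRem_eq (D : (ℝ → ℝ) → ℝ → ℝ) (P : Measure Ω) [IsProbabilityMeasure P] (N : ℕ)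
    (f : ℝ → ℝ) (X Y : Ω → ℝ) :
    revTaylorRem D P N f X Y = ∫ ω, f (X ω) ∂P -
      ∑ s ∈ Finset.range (N + 1), revCoeff P Y s * ∫ ω, (D^[s] f) (X ω + Y ω) ∂P := by
  have h1 (s : ℕ) : ∑ c : Composition s,
      (-1 : ℝ) ^ c.length * multiMoment P Y c.blocks * taylorRem D P (N - s) (D^[s] f) X Y =
      revCoeff P Y s * ∫ ω, (D^[s] f) (X ω + Y ω) ∂P -
      ∑ k ∈ Finset.range (N - s + 1),
        revCoeff P Y s * normMoment P Y k * ∫ ω, (D^[s + k] f) (X ω) ∂P := by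
    rw [← Finset.sum_mul, ← revCoeff, taylorRem, mul_sub, Finset.mul_sum]
    congr 1
    refine Finset.sum_congr rfl fun k _ => ?_
    rw [← Function.iterate_add_apply, add_comm k s, mul_assoc]
  -- Grouped by total order `j`, the coefficients convolve to the unit, so only `j = 0` survives.
  have h2 : ∑ j ∈ Finset.range (N + 1), ∑ k ∈ Finset.range (j + 1),
      revCoeff P Y (j - k) * normMoment P Y k * ∫ ω, (D^[j - k + k] f) (X ω) ∂P =
      ∫ ω, f (X ω) ∂P := by
    have (j : ℕ) : ∑ k ∈ Finset.range (j + 1),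
        revCoeff P Y (j - k) * normMoment P Y k * ∫ ω, (D^[j - k + k] f) (X ω) ∂P =
        (if j = 0 then 1 else 0) * ∫ ω, (D^[j] f) (X ω) ∂P := by
      rw [← sum_revCoeff_mul_normMoment P Y j, Finset.sum_mul]
      refine Finset.sum_congr rfl fun k hk => ?_
      rw [Nat.sub_add_cancel (by simp at hk; omega)]
    simp [this]
  simp only [revTaylorRem, h1, Finset.sum_sub_distrib]
  rw [sum_triangle N (fun s k => revCoeff P Y s * normMoment P Y k * ∫ ω, (D^[s + k] f) (X ω) ∂P),
    h2]
  ring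

/-- The expansion of `E[f(V + Y*)] - E[f(V + Y)]` in terms of the `E[f^(s)(V + Y)]`. -/
theorem integral_sub_integral_eq_expansion (D : (ℝ → ℝ) → ℝ → ℝ) (P : Measure Ω)
    [IsProbabilityMeasure P] (N : ℕ) (f : ℝ → ℝ) (V Y Ys : Ω → ℝ) :
    ∫ ω, f (V ω + Ys ω) ∂P - ∫ ω, f (V ω + Y ω) ∂P =
      ∑ s ∈ Finset.Icc 1 N, ∑ c : Composition s,
        expansionCoeff P Y Ys c.blocks * ∫ ω, (D^[s] f) (V ω + Y ω) ∂P
      + ∑ k ∈ Finset.range (N + 1),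
          revTaylorRem D P (N - k) (D^[k] f) V Y * normMoment P Ys k
      + taylorRem D P N f V Ys := by
  have h1 : ∑ k ∈ Finset.range (N + 1), ∑ s ∈ Finset.range (N - k + 1),
      revCoeff P Y s * normMoment P Ys k * ∫ ω, (D^[s + k] f) (V ω + Y ω) ∂P =
      ∫ ω, f (V ω + Y ω) ∂P + ∑ s ∈ Finset.Icc 1 N, ∑ c : Composition s,
        expansionCoeff P Y Ys c.blocks * ∫ ω, (D^[s] f) (V ω + Y ω) ∂P := by
    rw [sum_triangle N (fun k s => revCoeff P Y s * normMoment P Ys k *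
      ∫ ω, (D^[s + k] f) (V ω + Y ω) ∂P), sum_range_succ_eq_add_Icc]
    congr 1
    · simp [revCoeff_zero, normMoment_zero]
    · refine Finset.sum_congr rfl fun s hs => ?_
      rw [← Finset.sum_mul, sum_expansionCoeff_add P Y Ys (Finset.mem_Icc.mp hs).1,
        ← Finset.sum_range_reflect, Finset.sum_mul]
      refine Finset.sum_congr rfl fun k hk => ?_
      rw [Finset.mem_range] at hk
      have e1 : s + 1 - 1 - k = s - k := by omega
      have e2 : s - (s - k) = k := by omega
      rw [e1, e2, Nat.sub_add_cancel (by omega)]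
  have h2 : ∑ k ∈ Finset.range (N + 1),
      revTaylorRem D P (N - k) (D^[k] f) V Y * normMoment P Ys k =
      ∑ k ∈ Finset.range (N + 1), normMoment P Ys k * ∫ ω, (D^[k] f) (V ω) ∂P -
      ∑ k ∈ Finset.range (N + 1), ∑ s ∈ Finset.range (N - k + 1),
      revCoeff P Y s * normMoment P Ys k * ∫ ω, (D^[s + k] f) (V ω + Y ω) ∂P := by
    rw [← Finset.sum_sub_distrib]
    refine Finset.sum_congr rfl fun k _ => ?_
    rw [revTaylorRem_eq, sub_mul, Finset.sum_mul, mul_comm]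
    congr 1
    refine Finset.sum_congr rfl fun s _ => ?_
    rw [← Function.iterate_add_apply]
    ring
  rw [h2, h1, taylorRem]
  ring

end


/-! ### Existence, uniqueness and moments of the zero biased distribution -/

/-- The zero biased distribution of `μ`: the law of `U * Y`, with `U` uniform on `[0, 1]` and `Y`
independent of `U` and distributed according to the square bias of `μ`. -/
noncomputable def zeroBias (μ : Measure ℝ) : Measure ℝ :=
  ((μ.withDensity fun x => ENNReal.ofReal (x ^ 2 / ∫ y, y ^ 2 ∂μ)).prod
    (volume.restrict (Set.Icc 0 1))).map fun q => q.2 * q.1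

theorem measurable_sq_density (c : ℝ) : Measurable fun x : ℝ => ENNReal.ofReal (x ^ 2 / c) := by
  fun_prop

theorem isProbabilityMeasure_sqBias {μ : Measure ℝ} [IsProbabilityMeasure μ]
    (h2 : Integrable (fun x => x ^ 2) μ) (hpos : 0 < ∫ y, y ^ 2 ∂μ) :
    IsProbabilityMeasure (μ.withDensity fun x => ENNReal.ofReal (x ^ 2 / ∫ y, y ^ 2 ∂μ)) := by
  refine ⟨?_⟩
  rw [withDensity_apply _ MeasurableSet.univ, Measure.restrict_univ,
    ← ofReal_integral_eq_lintegral_ofReal (h2.div_const _)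
      (ae_of_all _ fun x => by positivity), integral_div, div_self hpos.ne', ENNReal.ofReal_one]

theorem isProbabilityMeasure_uniform : IsProbabilityMeasure (volume.restrict (Set.Icc (0:ℝ) 1)) :=
  ⟨by simp⟩

theorem isProbabilityMeasure_zeroBias {μ : Measure ℝ} [IsProbabilityMeasure μ]
    (h2 : Integrable (fun x => x ^ 2) μ) (hpos : 0 < ∫ y, y ^ 2 ∂μ) :
    IsProbabilityMeasure (zeroBias μ) := by
  have := isProbabilityMeasure_sqBias h2 hpos
  have := isProbabilityMeasure_uniform
  exact Measure.isProbabilityMeasure_map (by fun_prop)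

theorem integrable_sqBias_iff {μ : Measure ℝ} (hpos : 0 < ∫ y, y ^ 2 ∂μ) {g : ℝ → ℝ} :
    Integrable g (μ.withDensity fun x => ENNReal.ofReal (x ^ 2 / ∫ y, y ^ 2 ∂μ)) ↔
      Integrable (fun x => x ^ 2 / (∫ y, y ^ 2 ∂μ) * g x) μ := by
  rw [integrable_withDensity_iff_integrable_smul' (measurable_sq_density _)
    (ae_of_all _ fun _ => ENNReal.ofReal_lt_top)]
  refine integrable_congr (ae_of_all _ fun x => ?_)
  simp only [smul_eq_mul]
  rw [ENNReal.toReal_ofReal (by positivity)]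

theorem integral_sqBias {μ : Measure ℝ} (hpos : 0 < ∫ y, y ^ 2 ∂μ) (g : ℝ → ℝ) :
    ∫ x, g x ∂(μ.withDensity fun x => ENNReal.ofReal (x ^ 2 / ∫ y, y ^ 2 ∂μ)) =
      ∫ x, x ^ 2 / (∫ y, y ^ 2 ∂μ) * g x ∂μ := by
  rw [integral_withDensity_eq_integral_toReal_smul (measurable_sq_density _)
    (ae_of_all _ fun _ => ENNReal.ofReal_lt_top)]
  refine integral_congr_ae (ae_of_all _ fun x => ?_)
  simp only [smul_eq_mul]
  rw [ENNReal.toReal_ofReal (by positivity)]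

theorem ae_sqBias_iff {μ : Measure ℝ} (hpos : 0 < ∫ y, y ^ 2 ∂μ) {p : ℝ → Prop} :
    (∀ᵐ x ∂(μ.withDensity fun x => ENNReal.ofReal (x ^ 2 / ∫ y, y ^ 2 ∂μ)), p x) ↔
      ∀ᵐ x ∂μ, x ≠ 0 → p x := by
  rw [ae_withDensity_iff (measurable_sq_density _)]
  refine Filter.eventually_congr (ae_of_all _ fun x => ?_)
  have : ENNReal.ofReal (x ^ 2 / ∫ y, y ^ 2 ∂μ) ≠ 0 ↔ x ≠ 0 := by
    rw [ne_eq, ENNReal.ofReal_eq_zero, not_le]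
    constructor
    · rintro h rfl
      simp at h
    · intro h
      positivity
  rw [this]

/-- The factor `x ^ 2` of the square bias and the average of `f' (u * x)` over `u` in `[0, 1]`
combine to `x * (f x - f 0)`; the term `x * f 0` has mean zero. -/
theorem isZeroBias_zeroBias {μ : Measure ℝ} [IsProbabilityMeasure μ]
    (h2 : Integrable (fun x => x ^ 2) μ) (hpos : 0 < ∫ y, y ^ 2 ∂μ)
    (hvar : variance (fun x : ℝ => x) μ = ∫ y, y ^ 2 ∂μ)
    (h1 : Integrable (fun x => x) μ) (hmean : ∫ x, x ∂μ = 0) : IsZeroBias μ (zeroBias μ) := by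
  have := isProbabilityMeasure_sqBias h2 hpos
  have := isProbabilityMeasure_uniform
  intro f hf hxf hf'
  have hmeas : Measurable fun q : ℝ × ℝ => q.2 * q.1 := by fun_prop
  rw [zeroBias, integrable_map_measure (measurable_deriv f).aestronglyMeasurable
    hmeas.aemeasurable] at hf'
  change Integrable (fun q : ℝ × ℝ => deriv f (q.2 * q.1)) _ at hf'
  rw [hvar, zeroBias, integral_map hmeas.aemeasurable (measurable_deriv f).aestronglyMeasurable,
    integral_prod _ hf', integral_sqBias hpos, ← integral_const_mul]
  -- The derivative of a differentiable function need not be locally integrable. Fubini provides the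
  -- integrability of `u ↦ f' (u * x)` on `[0, 1]` for almost every nonzero `x`, which is what the
  -- fundamental theorem of calculus requires.
  have hae := (ae_sqBias_iff hpos).mp hf'.prod_right_ae
  have key : ∀ᵐ x ∂μ, (∫ y, y ^ 2 ∂μ) * (x ^ 2 / (∫ y, y ^ 2 ∂μ) *
      ∫ u in Set.Icc (0:ℝ) 1, deriv f (u * x)) = x * f x - x * f 0 := by
    filter_upwards [hae] with x hx
    rcases eq_or_ne x 0 with rfl | hx0
    · simp
    have hi : IntervalIntegrable (fun u => deriv f (u * x) * x) volume 0 1 := by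
      rw [intervalIntegrable_iff_integrableOn_Icc_of_le zero_le_one]
      exact (hx hx0).mul_const x
    have hftc := intervalIntegral.integral_eq_sub_of_hasDerivAt
      (f := fun u => f (u * x)) (f' := fun u => deriv f (u * x) * x) (a := 0) (b := 1)
      (fun u _ => by
        have h1 : HasDerivAt f (deriv f (u * x)) (u * x) := (hf _).hasDerivAt
        have h2 : HasDerivAt (fun u : ℝ => u * x) x u := by
          simpa using (hasDerivAt_id u).mul_const x
        exact h1.comp u h2) hi
    rw [intervalIntegral.integral_mul_const, intervalIntegral.integral_of_le zero_le_one,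
      ← integral_Icc_eq_integral_Ioc, one_mul, zero_mul] at hftc
    rw [← mul_sub, ← hftc]
    field_simp
  rw [integral_congr_ae key, integral_sub hxf (h1.mul_const _), integral_mul_const, hmean]
  simp

/-- Zero bias applied to primitives of bounded continuous functions. -/
theorem IsZeroBias.integral_boundedContinuous {μ ν : Measure ℝ} [IsProbabilityMeasure μ]
    [IsFiniteMeasure ν] (h2 : Integrable (fun x => x ^ 2) μ) (hν : IsZeroBias μ ν)
    (g : BoundedContinuousFunction ℝ ℝ) :
    ∫ x, x * (∫ t in (0:ℝ)..x, g t) ∂μ = variance (fun x : ℝ => x) μ * ∫ x, g x ∂ν := by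
  have hd (x : ℝ) : HasDerivAt (fun x => ∫ t in (0:ℝ)..x, g t) (g x) x :=
    intervalIntegral.integral_hasDerivAt_right (g.continuous.intervalIntegrable _ _)
      g.continuous.stronglyMeasurable.stronglyMeasurableAtFilter g.continuous.continuousAt
  have hdiff : Differentiable ℝ fun x => ∫ t in (0:ℝ)..x, g t := fun x => (hd x).differentiableAt
  have hderiv : deriv (fun x => ∫ t in (0:ℝ)..x, g t) = g := funext fun x => (hd x).deriv
  have := hν _ hdiff ?_ ?_
  · rwa [hderiv] at this
  · refine (h2.const_mul ‖g‖).mono'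
      (measurable_id.mul hdiff.continuous.measurable).aestronglyMeasurable
      (ae_of_all _ fun x => ?_)
    have := intervalIntegral.norm_integral_le_of_norm_le_const (a := 0) (b := x) (f := g)
      (C := ‖g‖) (fun t _ => g.norm_coe_le_norm t)
    rw [sub_zero] at this
    rw [norm_mul, Real.norm_eq_abs x]
    calc |x| * ‖∫ t in (0:ℝ)..x, g t‖ ≤ |x| * (‖g‖ * |x|) := by gcongr
      _ = ‖g‖ * x ^ 2 := by rw [← sq_abs x]; ring
  · rw [hderiv]
    exact g.integrable ν

/-- Every bounded continuous function is the derivative of an admissible test function, so the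
identity fixes its integral. -/
theorem IsZeroBias.unique {μ ν ν' : Measure ℝ} [IsProbabilityMeasure μ]
    [IsProbabilityMeasure ν] [IsProbabilityMeasure ν'] (h2 : Integrable (fun x => x ^ 2) μ)
    (hvar : 0 < variance (fun x : ℝ => x) μ) (hν : IsZeroBias μ ν) (hν' : IsZeroBias μ ν') :
    ν = ν' := by
  refine ext_of_forall_integral_eq_of_IsFiniteMeasure fun g => ?_
  have h := hν.integral_boundedContinuous h2 g
  rw [hν'.integral_boundedContinuous h2 g] at h
  exact (mul_left_cancel₀ hvar.ne' h).symm

/-- The square bias costs two moments, and multiplication by a uniform variable in `[0, 1]` only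
decreases absolute values. -/
theorem integrable_rpow_zeroBias {μ : Measure ℝ} [IsProbabilityMeasure μ]
    (h2 : Integrable (fun x => x ^ 2) μ) (hpos : 0 < ∫ y, y ^ 2 ∂μ) {r : ℝ} (hr : 0 ≤ r)
    (hi : Integrable (fun x => |x| ^ (r + 2)) μ) :
    Integrable (fun x => |x| ^ r) (zeroBias μ) := by
  have := isProbabilityMeasure_sqBias h2 hpos
  have := isProbabilityMeasure_uniform
  have hmeas : Measurable fun q : ℝ × ℝ => q.2 * q.1 := by fun_prop
  have hm : Measurable fun x : ℝ => |x| ^ r := by fun_prop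
  rw [zeroBias, integrable_map_measure hm.aestronglyMeasurable hmeas.aemeasurable]
  have h1 : Integrable (fun x => |x| ^ r)
      (μ.withDensity fun x => ENNReal.ofReal (x ^ 2 / ∫ y, y ^ 2 ∂μ)) := by
    rw [integrable_sqBias_iff hpos]
    refine (hi.div_const (∫ y, y ^ 2 ∂μ)).congr (ae_of_all _ fun x => ?_)
    simp only
    rw [Real.rpow_add_of_nonneg (abs_nonneg x) hr (by norm_num), Real.rpow_two, sq_abs]
    ring
  have hprod := h1.comp_fst (volume.restrict (Set.Icc (0:ℝ) 1))
  refine hprod.mono' (hm.comp hmeas).aestronglyMeasurable ?_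
  have hq : ∀ᵐ q : ℝ × ℝ ∂((μ.withDensity fun x => ENNReal.ofReal (x ^ 2 / ∫ y, y ^ 2 ∂μ)).prod
      (volume.restrict (Set.Icc (0:ℝ) 1))), q.2 ∈ Set.Icc (0:ℝ) 1 :=
    Measure.quasiMeasurePreserving_snd.ae (ae_restrict_mem measurableSet_Icc)
  filter_upwards [hq] with q hq
  simp only [Function.comp]
  rw [Real.norm_of_nonneg (by positivity)]
  refine Real.rpow_le_rpow (abs_nonneg _) ?_ hr
  rw [abs_mul, abs_of_nonneg hq.1]
  exact mul_le_of_le_one_left (abs_nonneg _) hq.2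

theorem existsUnique_isZeroBias {μ : Measure ℝ} [IsProbabilityMeasure μ]
    (h2 : Integrable (fun x => x ^ 2) μ) (hpos : 0 < ∫ y, y ^ 2 ∂μ)
    (hvar : variance (fun x : ℝ => x) μ = ∫ y, y ^ 2 ∂μ)
    (h1 : Integrable (fun x => x) μ) (hmean : ∫ x, x ∂μ = 0) :
    ∃! ν : Measure ℝ, IsProbabilityMeasure ν ∧ IsZeroBias μ ν := by
  have hp := isProbabilityMeasure_zeroBias h2 hpos
  refine ⟨zeroBias μ, ⟨hp, isZeroBias_zeroBias h2 hpos hvar h1 hmean⟩, ?_⟩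
  rintro ν ⟨_, hν⟩
  exact hν.unique h2 (hvar ▸ hpos) (isZeroBias_zeroBias h2 hpos hvar h1 hmean)


open Filter Topology
/-! ### Functions of polynomial growth -/

/-- `|f x| ≤ C (1 + |x|)^r` for some constant `C`; the exponent may be negative. -/
def PolyGrowth (r : ℝ) (f : ℝ → ℝ) : Prop := ∃ C : ℝ, ∀ x, |f x| ≤ C * (1 + |x|) ^ r

theorem one_le_one_add_abs (x : ℝ) : 1 ≤ 1 + |x| := le_add_of_nonneg_right (abs_nonneg x)

theorem one_add_abs_pos (x : ℝ) : 0 < 1 + |x| := zero_lt_one.trans_le (one_le_one_add_abs x)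

theorem rpow_one_add_abs_pos (r x : ℝ) : 0 < (1 + |x|) ^ r :=
  Real.rpow_pos_of_pos (one_add_abs_pos x) r

namespace PolyGrowth

variable {r s : ℝ} {f g : ℝ → ℝ}

theorem exists_nonneg (hf : PolyGrowth r f) : ∃ C : ℝ, 0 ≤ C ∧ ∀ x, |f x| ≤ C * (1 + |x|) ^ r := by
  obtain ⟨C, hC⟩ := hf
  exact ⟨C, nonneg_of_mul_nonneg_left ((abs_nonneg _).trans (hC 0)) (rpow_one_add_abs_pos r 0), hC⟩

theorem mono (hf : PolyGrowth r f) (h : r ≤ s) : PolyGrowth s f := by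
  obtain ⟨C, hC0, hC⟩ := hf.exists_nonneg
  refine ⟨C, fun x => (hC x).trans ?_⟩
  have := one_le_one_add_abs x
  gcongr

theorem add (hf : PolyGrowth r f) (hg : PolyGrowth r g) : PolyGrowth r fun x => f x + g x := by
  obtain ⟨C, hC⟩ := hf
  obtain ⟨C', hC'⟩ := hg
  refine ⟨C + C', fun x => (abs_add_le _ _).trans ?_⟩
  rw [add_mul]
  exact add_le_add (hC x) (hC' x)

theorem const_mul (c : ℝ) (hf : PolyGrowth r f) : PolyGrowth r fun x => c * f x := by
  obtain ⟨C, hC⟩ := hf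
  refine ⟨|c| * C, fun x => ?_⟩
  rw [abs_mul, mul_assoc]
  exact mul_le_mul_of_nonneg_left (hC x) (abs_nonneg c)

theorem neg (hf : PolyGrowth r f) : PolyGrowth r fun x => -f x := by
  simpa using hf.const_mul (-1)

theorem sub (hf : PolyGrowth r f) (hg : PolyGrowth r g) : PolyGrowth r fun x => f x - g x := by
  simpa [sub_eq_add_neg] using hf.add hg.neg

theorem id_mul (hf : PolyGrowth r f) : PolyGrowth (r + 1) fun x => x * f x := by
  obtain ⟨C, hC⟩ := hf
  refine ⟨C, fun x => ?_⟩
  rw [abs_mul, Real.rpow_add_one (one_add_abs_pos x).ne', mul_comm, ← mul_assoc]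
  exact mul_le_mul (hC x) (by linarith) (abs_nonneg _) ((abs_nonneg _).trans (hC x))

theorem const (c : ℝ) (hr : 0 ≤ r) : PolyGrowth r fun _ => c := by
  refine ⟨|c|, fun x => ?_⟩
  exact le_mul_of_one_le_right (abs_nonneg c) (Real.one_le_rpow (one_le_one_add_abs x) hr)

/-- A function that is bounded on compact sets and of polynomial growth near infinity. -/
theorem of_bounded {R C : ℝ} (hb : ∃ B, ∀ x, |x| ≤ R → |f x| ≤ B)
    (hi : ∀ x, R ≤ |x| → |f x| ≤ C * (1 + |x|) ^ r) : PolyGrowth r f := by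
  obtain ⟨B, hB⟩ := hb
  -- The second constant works for either sign of `r`: on `|x| ≤ R` the factor `(1 + |R|) ^ |r|`
  -- compensates the possible smallness of `(1 + |x|) ^ r`.
  refine ⟨max C (|B| * (1 + |R|) ^ |r|), fun x => ?_⟩
  have hp := rpow_one_add_abs_pos r x
  rcases le_total R |x| with h | h
  · exact (hi x h).trans (mul_le_mul_of_nonneg_right (le_max_left _ _) hp.le)
  · have h1 : 1 ≤ (1 + |R|) ^ |r| * (1 + |x|) ^ r := by
      have h2 : (1 + |x|) ^ (-r) ≤ (1 + |R|) ^ |r| :=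
        (Real.rpow_le_rpow_of_exponent_le (one_le_one_add_abs x) (neg_le_abs r)).trans
          (Real.rpow_le_rpow (one_add_abs_pos x).le
            (by linarith [le_abs_self R]) (abs_nonneg r))
      calc (1 : ℝ) = (1 + |x|) ^ (-r) * (1 + |x|) ^ r := by
            rw [← Real.rpow_add (one_add_abs_pos x)]; simp
        _ ≤ _ := by gcongr
    calc |f x| ≤ |B| * 1 := by rw [mul_one]; exact (hB x h).trans (le_abs_self B)
      _ ≤ |B| * ((1 + |R|) ^ |r| * (1 + |x|) ^ r) := by gcongr
      _ = (|B| * (1 + |R|) ^ |r|) * (1 + |x|) ^ r := by ring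
      _ ≤ _ := mul_le_mul_of_nonneg_right (le_max_right _ _) hp.le

/-- This makes the arbitrary values of derivatives at the exceptional points harmless. -/
theorem congr_finite (hf : PolyGrowth r f) (h : {x | g x ≠ f x}.Finite) : PolyGrowth r g := by
  obtain ⟨C, hC⟩ := hf
  obtain ⟨B, hB⟩ := (h.image fun x => |g x| / (1 + |x|) ^ r).bddAbove
  refine ⟨max C B, fun x => ?_⟩
  have hp := rpow_one_add_abs_pos r x
  by_cases hx : g x = f x
  · rw [hx]
    exact (hC x).trans (mul_le_mul_of_nonneg_right (le_max_left _ _) hp.le)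
  · rw [← div_le_iff₀ hp]
    exact (hB (Set.mem_image_of_mem _ hx)).trans (le_max_right _ _)

theorem integrable_comp {Ω : Type*} [MeasurableSpace Ω] {P : Measure Ω} [IsProbabilityMeasure P]
    {Y : Ω → ℝ} {M : ℝ} (hf : PolyGrowth r f) (hfm : Measurable f) (hM : 0 ≤ M) (hr : r ≤ M)
    (hY : MemLp Y (ENNReal.ofReal M) P) : Integrable (fun ω => f (Y ω)) P := by
  obtain ⟨C, hC0, hC⟩ := (hf.mono hr).exists_nonneg
  have h1 : MemLp (fun ω => 1 + |Y ω|) (ENNReal.ofReal M) P :=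
    (memLp_const (1 : ℝ)).add hY.abs
  have h2 := h1.integrable_norm_rpow'
  rw [ENNReal.toReal_ofReal hM] at h2
  have h3 : Integrable (fun ω => C * (1 + |Y ω|) ^ M) P := by
    refine (h2.const_mul C).congr (ae_of_all _ fun ω => ?_)
    simp only [Real.norm_of_nonneg (one_add_abs_pos (Y ω)).le]
  exact h3.mono' (hfm.comp_aemeasurable hY.1.aemeasurable).aestronglyMeasurable
    (ae_of_all _ fun ω => hC (Y ω))

theorem tendsto_mul_gaussian (hf : PolyGrowth r f) {v : ℝ} (hv : 0 < v) :
    Tendsto (fun x => f x * Real.exp (-x ^ 2 / (2 * v))) (cocompact ℝ) (𝓝 0) := by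
  obtain ⟨C, hC0, hC⟩ := (hf.mono (le_max_left r 0)).exists_nonneg
  set R := max r 0
  have hR : 0 ≤ R := le_max_right _ _
  -- The factor `2 ^ R` comes from `1 + |x| ≤ 2 * |x|` for `|x| ≥ 1`.
  have h := (tendsto_rpow_abs_mul_exp_neg_mul_sq_cocompact
    (show 0 < 1 / (2 * v) by positivity) R).const_mul (C * 2 ^ R)
  rw [mul_zero] at h
  refine squeeze_zero_norm' ?_ h
  have h1 : ∀ᶠ x : ℝ in cocompact ℝ, 1 ≤ |x| :=
    (tendsto_norm_cocompact_atTop (E := ℝ)).eventually_ge_atTop 1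
  filter_upwards [h1] with x hx
  have e : -x ^ 2 / (2 * v) = -(1 / (2 * v)) * x ^ 2 := by ring
  rw [norm_mul, Real.norm_eq_abs, Real.norm_of_nonneg (Real.exp_pos _).le, e, ← mul_assoc]
  refine mul_le_mul_of_nonneg_right ((hC x).trans ?_) (Real.exp_pos _).le
  rw [mul_assoc, ← Real.mul_rpow (by norm_num) (abs_nonneg x)]
  have := one_add_abs_pos x
  gcongr
  linarith

end PolyGrowth

theorem measurable_of_finite_discontinuities {f : ℝ → ℝ} (h : {x | ¬ ContinuousAt f x}.Finite) :
    Measurable f := by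
  refine measurable_of_measurable_on_compl_finite _ h (Continuous.measurable ?_)
  refine continuousOn_iff_continuous_domRestrict.mp fun x hx => ?_
  simp only [Set.mem_compl_iff, Set.mem_ofPred_eq, not_not] at hx
  exact hx.continuousWithinAt

theorem PolyGrowth.intervalIntegrable {r : ℝ} {f : ℝ → ℝ} (hf : PolyGrowth r f)
    (hm : Measurable f) (a b : ℝ) : IntervalIntegrable f volume a b := by
  obtain ⟨C, hC⟩ := hf
  refine IntervalIntegrable.mono_fun' (g := fun x => C * (1 + |x|) ^ r)
    (Continuous.intervalIntegrable ?_ a b) hm.aestronglyMeasurable (ae_of_all _ hC)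
  exact continuous_const.mul ((continuous_const.add continuous_abs).rpow_const
    fun x => Or.inl (one_add_abs_pos x).ne')

/-! ### Primitives -/

namespace IsPrimitive

variable {F f : ℝ → ℝ}

theorem continuous (h : IsPrimitive F f) : Continuous F := by
  have : F = fun x => F 0 + ∫ t in (0 : ℝ)..x, f t := funext h.2
  rw [this]
  exact continuous_const.add (intervalIntegral.continuous_primitive (fun a b => h.1 a b) 0)

theorem hasDerivAt (h : IsPrimitive F f) {x : ℝ} (hx : ContinuousAt f x) :
    HasDerivAt F (f x) x := by
  have : F = fun x => F 0 + ∫ t in (0 : ℝ)..x, f t := funext h.2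
  rw [this]
  refine HasDerivAt.const_add _ (intervalIntegral.integral_hasDerivAt_right (h.1 0 x) ?_ hx)
  refine ⟨Set.Icc (x - 1) (x + 1), Icc_mem_nhds (by linarith) (by linarith), ?_⟩
  exact ((intervalIntegrable_iff_integrableOn_Icc_of_le (by linarith)).mp
    (h.1 (x - 1) (x + 1))).aestronglyMeasurable

theorem polyGrowth (h : IsPrimitive F f) {r : ℝ} (hr : 0 ≤ r) (hf : PolyGrowth r f) :
    PolyGrowth (r + 1) F := by
  obtain ⟨C, hC0, hC⟩ := hf.exists_nonneg
  have h1 : PolyGrowth (r + 1) fun x => ∫ t in (0 : ℝ)..x, f t := by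
    refine ⟨C, fun x => ?_⟩
    have := intervalIntegral.norm_integral_le_of_norm_le_const (a := 0) (b := x) (f := f)
      (C := C * (1 + |x|) ^ r) (fun t ht => by
        refine (hC t).trans ?_
        have ht' : |t| ≤ |x| := by
          rcases Set.mem_uIoc.mp ht with h | h
          · rw [abs_of_nonneg h.1.le, abs_of_nonneg (h.1.le.trans h.2)]; exact h.2
          · rw [abs_of_nonpos h.2, abs_of_nonpos (h.1.le.trans h.2)]; linarith [h.1]
        have := one_add_abs_pos t
        gcongr)
    rw [sub_zero] at this
    refine this.trans ?_
    rw [Real.rpow_add_one (one_add_abs_pos x).ne', ← mul_assoc]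
    have := rpow_one_add_abs_pos r x
    gcongr
    linarith
  exact ((PolyGrowth.const (F 0) (by linarith)).add h1).congr_finite (by simp [← h.2])

/-- A continuous function is a primitive of its derivative if this is locally integrable and
exists outside a finite set. -/
theorem of_hasDerivAt_off_finite (hF : Continuous F) {S : Set ℝ} (hS : S.Finite)
    (hd : ∀ x ∉ S, HasDerivAt F (f x) x) (hi : ∀ a b, IntervalIntegrable f volume a b) :
    IsPrimitive F f := by
  refine ⟨hi, fun x => ?_⟩
  rw [integral_eq_of_hasDerivAt_off_countable F f hS.countable hF.continuousOn
    (fun y hy => hd y hy.2) (hi 0 x)]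
  ring

end IsPrimitive

/-! ### Growth of the solutions of Stein's equation -/

/-- The barrier `2 * C * (1 + x) ^ (r - 1)` is eventually a supersolution. Its difference with `u`,
multiplied by the Gaussian weight, is eventually decreasing; because `u` times the weight tends to
zero, this quantity cannot become negative. -/
theorem eventually_le_of_stein {v : ℝ} (hv : 0 < v) {u k : ℝ → ℝ} {C r : ℝ} (hC : 0 ≤ C)
    (hu : ∀ᶠ x in atTop, HasDerivAt u ((x * u x - k x) / v) x)
    (hk : ∀ᶠ x in atTop, k x ≤ C * (1 + x) ^ r)
    (h0 : Tendsto (fun x => u x * Real.exp (-x ^ 2 / (2 * v))) atTop (𝓝 0)) :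
    ∀ᶠ x in atTop, u x ≤ 2 * C * (1 + x) ^ (r - 1) := by
  -- With `x ≥ 1`, the last condition gives `x ^ 2 - 1 ≥ 2 * v * (r - 1)`, exactly the inequality
  -- that makes the derivative of `G` nonpositive once the bound on `k` is inserted.
  obtain ⟨x₀, hx₀⟩ := eventually_atTop.mp ((hu.and hk).and
    ((eventually_ge_atTop 1).and (eventually_ge_atTop (1 + 2 * v * (r - 1)))))
  set E : ℝ → ℝ := fun x => Real.exp (-x ^ 2 / (2 * v))
  have hE (x : ℝ) : HasDerivAt E (-(x / v) * E x) x := by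
    have h1 : HasDerivAt (fun x : ℝ => -x ^ 2 / (2 * v)) (-(x / v)) x := by
      have := ((hasDerivAt_pow 2 x).neg).div_const (2 * v)
      refine this.congr_deriv ?_
      field_simp
      simp
    exact h1.exp.congr_deriv (mul_comm _ _)
  set G : ℝ → ℝ := fun x => (2 * C * (1 + x) ^ (r - 1) - u x) * E x
  have hG (x : ℝ) (hx : x₀ ≤ x) : ∃ G', HasDerivAt G G' x ∧ G' ≤ 0 := by
    obtain ⟨⟨h1, h2⟩, h3, h4⟩ := hx₀ x hx
    have hx1 : 0 < 1 + x := by linarith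
    have hw : HasDerivAt (fun x : ℝ => (1 + x) ^ (r - 1)) ((r - 1) * (1 + x) ^ (r - 2)) x := by
      have := (((hasDerivAt_id x).const_add 1).rpow_const (p := r - 1) (Or.inl hx1.ne'))
      refine this.congr_deriv ?_
      rw [one_mul, show r - 2 = r - 1 - 1 by ring]
      rfl
    refine ⟨_, ((hw.const_mul (2 * C)).sub h1).mul (hE x), ?_⟩
    set T := (1 + x) ^ (r - 2)
    have hT : 0 < T := Real.rpow_pos_of_pos hx1 _
    have e1 : (1 + x) ^ (r - 1) = T * (1 + x) := by
      rw [← Real.rpow_add_one hx1.ne']; congr 1; ring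
    have e2 : (1 + x) ^ r = T * (1 + x) * (1 + x) := by
      rw [← Real.rpow_add_one hx1.ne', ← Real.rpow_add_one hx1.ne']; congr 1; ring
    rw [e2] at h2
    simp only [Pi.sub_apply, e1]
    have h5 : 0 ≤ C * T * (x ^ 2 - 1 - 2 * v * (r - 1)) := by
      have : 0 ≤ x ^ 2 - 1 - 2 * v * (r - 1) := by
        nlinarith
      positivity
    have h6 : (2 * C * ((r - 1) * T) - (x * u x - k x) / v) * E x +
        (2 * C * (T * (1 + x)) - u x) * (-(x / v) * E x) =
        (2 * C * T * (v * (r - 1)) + k x - 2 * C * T * (1 + x) * x) * E x / v := by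
      field_simp
      ring
    rw [h6]
    refine div_nonpos_of_nonpos_of_nonneg (mul_nonpos_of_nonpos_of_nonneg ?_ (Real.exp_pos _).le)
      hv.le
    nlinarith
  have hanti : AntitoneOn G (Set.Ici x₀) := by
    have hd (x : ℝ) (hx : x₀ ≤ x) : DifferentiableAt ℝ G x :=
      let ⟨_, h, _⟩ := hG x hx
      h.differentiableAt
    refine antitoneOn_of_deriv_nonpos (convex_Ici x₀)
      (fun x hx => (hd x hx).continuousAt.continuousWithinAt)
      (fun x hx => (hd x (interior_subset hx)).differentiableWithinAt) fun x hx => ?_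
    obtain ⟨G', h, h'⟩ := hG x (interior_subset hx)
    rwa [h.deriv]
  filter_upwards [eventually_ge_atTop x₀] with x hx
  have hGx : 0 ≤ G x := by
    have h1 : Tendsto (fun y => -(u y * E y)) atTop (𝓝 0) := by simpa using h0.neg
    refine le_of_tendsto h1 ?_
    filter_upwards [eventually_ge_atTop x] with y hy
    refine le_trans ?_ (hanti hx (hx.trans hy) hy)
    obtain ⟨-, h3, -⟩ := hx₀ y (hx.trans hy)
    have h4 : 0 ≤ 2 * C * (1 + y) ^ (r - 1) * E y :=
      mul_nonneg (mul_nonneg (by linarith) (Real.rpow_nonneg (by linarith) _)) (Real.exp_pos _).le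
    simp only [G]
    linarith
  have := nonneg_of_mul_nonneg_left hGx (Real.exp_pos _)
  linarith

theorem eventually_abs_le_of_stein {v : ℝ} (hv : 0 < v) {u k : ℝ → ℝ} {C r : ℝ} (hC : 0 ≤ C)
    (hu : ∀ᶠ x in atTop, HasDerivAt u ((x * u x - k x) / v) x)
    (hk : ∀ x, |k x| ≤ C * (1 + |x|) ^ r)
    (h0 : Tendsto (fun x => u x * Real.exp (-x ^ 2 / (2 * v))) atTop (𝓝 0)) :
    ∀ᶠ x in atTop, |u x| ≤ 2 * C * (1 + |x|) ^ (r - 1) := by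
  have h1 := eventually_le_of_stein (r := r) hv hC hu (by
    filter_upwards [eventually_ge_atTop 0] with x hx
    have := hk x
    rw [abs_of_nonneg hx] at this
    exact (le_abs_self _).trans this) h0
  have h2 := eventually_le_of_stein (u := fun x => -u x) (k := fun x => -k x) (r := r) hv hC (by
    filter_upwards [hu] with x hx
    exact hx.neg.congr_deriv (by ring)) (by
    filter_upwards [eventually_ge_atTop 0] with x hx
    have := hk x
    rw [abs_of_nonneg hx] at this
    exact (neg_le_abs _).trans this) (by simpa using h0.neg)
  filter_upwards [h1, h2, eventually_ge_atTop 0] with x h1 h2 h3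
  rw [abs_of_nonneg h3]
  exact abs_le.mpr ⟨by linarith, h1⟩

/-- The solution of Stein's equation gains one power. -/
theorem PolyGrowth.of_stein {v : ℝ} (hv : 0 < v) {u k : ℝ → ℝ} {r : ℝ} (hk : PolyGrowth r k)
    (huc : Continuous u) (hu : {x | ¬ HasDerivAt u ((x * u x - k x) / v) x}.Finite)
    (h0 : Tendsto (fun x => u x * Real.exp (-x ^ 2 / (2 * v))) (cocompact ℝ) (𝓝 0)) :
    PolyGrowth (r - 1) u := by
  obtain ⟨C, hC0, hC⟩ := hk.exists_nonneg
  have hev : ∀ᶠ x in cocompact ℝ, HasDerivAt u ((x * u x - k x) / v) x := by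
    have := hu.isCompact.compl_mem_cocompact
    filter_upwards [this] with x hx
    simpa using hx
  rw [cocompact_eq_atBot_atTop] at hev h0
  have h1 := eventually_abs_le_of_stein hv hC0 (eventually_sup.mp hev).2 hC (tendsto_sup.mp h0).2
  -- Reflection preserves the form of the equation and turns the right-hand side into `-k (-x)`, so
  -- the behaviour at `-∞` follows from that at `+∞`.
  have h2 := eventually_abs_le_of_stein (u := fun x => u (-x)) (k := fun x => -k (-x)) (r := r)
    hv hC0 (by
      filter_upwards [tendsto_neg_atTop_atBot.eventually (eventually_sup.mp hev).1] with x hx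
      have := hx.comp x (hasDerivAt_neg x)
      exact this.congr_deriv (by ring)) (fun x => by simpa using hC (-x)) (by
      have := (tendsto_sup.mp h0).1.comp tendsto_neg_atTop_atBot
      simpa [Function.comp_def] using this)
  obtain ⟨R, hR⟩ := eventually_atTop.mp (h1.and h2)
  refine PolyGrowth.of_bounded (R := |R|) (C := 2 * C) ?_ fun x hx => ?_
  · obtain ⟨B, hB⟩ := (isCompact_Icc (a := -|R|) (b := |R|)).exists_bound_of_continuousOn
      huc.continuousOn
    exact ⟨B, fun x hx => hB x (abs_le.mp hx)⟩
  · rcases le_total 0 x with h | h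
    · rw [abs_of_nonneg h] at hx
      exact (hR x ((le_abs_self R).trans hx)).1
    · rw [abs_of_nonpos h] at hx
      simpa using (hR (-x) ((le_abs_self R).trans hx)).2


/-! ### The solution of Stein's equation -/

section SteinSol

variable {v : NNReal} {h : ℝ → ℝ}

theorem integrable_gaussianReal_iff (hv : v ≠ 0) {g : ℝ → ℝ} :
    Integrable g (gaussianReal 0 v) ↔ Integrable (fun t => g t * gaussianPDFReal 0 v t) := by
  rw [gaussianReal_of_var_ne_zero _ hv, integrable_withDensity_iff_integrable_smul'
    (measurable_gaussianPDF _ _) (ae_of_all _ fun _ => gaussianPDF_lt_top)]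
  refine integrable_congr (ae_of_all _ fun x => ?_)
  simp [toReal_gaussianPDF, mul_comm]

theorem integrable_centered (hv : v ≠ 0) (hh : Integrable h (gaussianReal 0 v)) :
    Integrable fun t => (h t - normalExp v h) * gaussianPDFReal 0 v t :=
  (integrable_gaussianReal_iff hv).mp (hh.sub (integrable_const _))

theorem integral_centered (hv : v ≠ 0) (hh : Integrable h (gaussianReal 0 v)) :
    ∫ t, (h t - normalExp v h) * gaussianPDFReal 0 v t = 0 := by
  have h1 := integral_gaussianReal_eq_integral_smul (μ := 0) (f := fun t => h t - normalExp v h) hv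
  rw [integral_sub hh (integrable_const _)] at h1
  simp only [smul_eq_mul, mul_comm (gaussianPDFReal _ _ _)] at h1
  rw [← h1]
  simp [normalExp]

theorem steinSolWellDefined (hv : v ≠ 0) (hh : Integrable h (gaussianReal 0 v)) :
    SteinSolWellDefined v h :=
  ⟨hh, fun _ => (integrable_centered hv hh).integrableOn⟩

theorem hasDerivAt_steinSol (hv : v ≠ 0) (hh : Integrable h (gaussianReal 0 v)) {x : ℝ}
    (hx : ContinuousAt h x) :
    HasDerivAt (steinSol v h) ((x * steinSol v h x - (h x - normalExp v h)) / v) x := by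
  have hv' : (v : ℝ) ≠ 0 := by exact_mod_cast hv
  set k : ℝ → ℝ := fun t => (h t - normalExp v h) * gaussianPDFReal 0 v t with hk
  have hki : Integrable k := integrable_centered hv hh
  have hφ : HasDerivAt (gaussianPDFReal 0 v) (-(x / v) * gaussianPDFReal 0 v x) x := by
    have h1 : HasDerivAt (fun y : ℝ => -(y - 0) ^ 2 / (2 * v)) (-(x / v)) x := by
      have := (((hasDerivAt_id x).sub_const 0).pow 2).neg.div_const (2 * (v : ℝ))
      refine this.congr_deriv ?_
      simp
      field_simp
    have h2 := h1.exp.const_mul (√(2 * Real.pi * v))⁻¹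
    refine h2.congr_deriv ?_
    simp only [gaussianPDFReal]
    ring
  have hφpos := gaussianPDFReal_pos 0 v x hv
  have hkc : ContinuousAt k x := (hx.sub continuousAt_const).mul hφ.continuousAt
  have hJ : HasDerivAt (fun y => ∫ t in Set.Ioi y, k t) (-k x) x := by
    have e : (fun y => ∫ t in Set.Ioi y, k t) =
        fun y => (∫ t in Set.Ioi (0 : ℝ), k t) - ∫ t in (0 : ℝ)..y, k t := by
      funext y
      rw [← intervalIntegral.integral_Ioi_sub_Ioi' hki.integrableOn hki.integrableOn]
      ring
    rw [e]
    exact (intervalIntegral.integral_hasDerivAt_right hki.intervalIntegrable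
      hki.1.stronglyMeasurableAtFilter hkc).const_sub _
  have h3 := ((hφ.const_mul (v : ℝ)).inv (by positivity)).mul hJ
  have e : steinSol v h = fun y => ((v : ℝ) * gaussianPDFReal 0 v y)⁻¹ *
      ∫ t in Set.Ioi y, k t := by
    funext y
    simp only [steinSol, one_div, hk]
  rw [e]
  refine h3.congr_deriv ?_
  simp only [Pi.inv_apply, hk]
  field_simp
  ring

/-- The weight cancels the density up to a constant and leaves the tail integral of the centered
function. This vanishes at `-∞` too because the full integral is zero; the limit there selects this
solution of the equation. -/
theorem tendsto_steinSol_mul_gaussian (hv : v ≠ 0) (hh : Integrable h (gaussianReal 0 v)) :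
    Tendsto (fun x => steinSol v h x * Real.exp (-x ^ 2 / (2 * v))) (cocompact ℝ) (𝓝 0) := by
  have hv' : (v : ℝ) ≠ 0 := by exact_mod_cast hv
  have hvpos : (0 : ℝ) < v := lt_of_le_of_ne v.2 hv'.symm
  set k : ℝ → ℝ := fun t => (h t - normalExp v h) * gaussianPDFReal 0 v t with hk
  have hki : Integrable k := integrable_centered hv hh
  have e : (fun x => steinSol v h x * Real.exp (-x ^ 2 / (2 * v))) =
      fun x => (√(2 * Real.pi * v) / v) * ∫ t in Set.Ioi x, k t := by
    funext x
    have hs : √(2 * Real.pi * v) ≠ 0 := by positivity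
    simp only [steinSol, gaussianPDFReal, sub_zero, hk]
    have := (Real.exp_pos (-x ^ 2 / (2 * v))).ne'
    field_simp
  have hJ : Tendsto (fun x => ∫ t in Set.Ioi x, k t) (cocompact ℝ) (𝓝 0) := by
    rw [cocompact_eq_atBot_atTop]
    refine Tendsto.sup ?_ ?_
    · have h1 := (intervalIntegral_tendsto_integral_Iic 0 hki.integrableOn tendsto_id).add_const
        (∫ t in Set.Ioi (0 : ℝ), k t)
      rw [intervalIntegral.integral_Iic_add_Ioi hki.integrableOn hki.integrableOn,
        integral_centered hv hh] at h1
      refine h1.congr fun x => ?_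
      exact intervalIntegral.integral_interval_add_Ioi hki.integrableOn hki.integrableOn
    · have h1 := (intervalIntegral_tendsto_integral_Ioi 0 hki.integrableOn tendsto_id).const_sub
        (∫ t in Set.Ioi (0 : ℝ), k t)
      rw [sub_self] at h1
      refine h1.congr fun x => ?_
      rw [id, ← intervalIntegral.integral_Ioi_sub_Ioi' hki.integrableOn hki.integrableOn]
      ring
  rw [e]
  simpa using hJ.const_mul (√(2 * Real.pi * v) / v)

end SteinSol

/-! ### Derivatives of the solution of Stein's equation -/

/-- `N`-fold primitives of functions with finitely many discontinuities and growth `q`. -/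
def FiniteOrderClass (N : ℕ) (q : ℝ) (h : ℝ → ℝ) : Prop :=
  ∃ H : ℕ → ℝ → ℝ, H 0 = h ∧ (∀ k < N, IsPrimitive (H k) (H (k + 1))) ∧
    {x | ¬ ContinuousAt (H N) x}.Finite ∧ PolyGrowth q (H N)

theorem polyGrowth_of_chain {N : ℕ} {q : ℝ} (hq : 0 ≤ q) {G : ℕ → ℝ → ℝ}
    (hG : ∀ k < N, IsPrimitive (G k) (G (k + 1))) (hN : PolyGrowth q (G N)) {k : ℕ} (hk : k ≤ N) :
    PolyGrowth ((N : ℝ) - k + q) (G k) := by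
  induction hk using Nat.decreasingInduction with
  | self => simpa using hN
  | of_succ k hk ih =>
    have hk' : (k : ℝ) + 1 ≤ N := by exact_mod_cast hk
    refine ((hG k hk).polyGrowth ?_ ih).mono (le_of_eq ?_)
    · push_cast
      linarith
    · push_cast
      ring

theorem FiniteOrderClass.polyGrowth {N : ℕ} {q : ℝ} {h : ℝ → ℝ} (hq : 0 ≤ q)
    (hh : FiniteOrderClass N q h) : PolyGrowth (N + q) h := by
  obtain ⟨H, rfl, hH, -, hN⟩ := hh
  simpa using polyGrowth_of_chain hq hH hN (Nat.zero_le N)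

theorem FiniteOrderClass.measurable {N : ℕ} {q : ℝ} {h : ℝ → ℝ}
    (hh : FiniteOrderClass N q h) : Measurable h := by
  obtain ⟨H, rfl, hH, hN, -⟩ := hh
  rcases N with _ | N
  · exact measurable_of_finite_discontinuities hN
  · exact (hH 0 N.succ_pos).continuous.measurable

/-- The successive derivatives of a solution `f` of `v f' = x f - G 0`, where `G k` are the
successive derivatives of `G 0`, obtained by differentiating the equation. -/
noncomputable def steinDeriv (v : ℝ) (f : ℝ → ℝ) (G : ℕ → ℝ → ℝ) : ℕ → ℝ → ℝ
  | 0 => f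
  | 1 => fun x => (x * f x - G 0 x) / v
  | k + 2 => fun x => (x * steinDeriv v f G (k + 1) x + (k + 1) * steinDeriv v f G k x
      - G (k + 1) x) / v

/-- What is needed of the iterated derivatives, up to the order `N + 1`, of the solution `f` of
Stein's equation with variance `v` and right-hand side `g`. -/
structure SteinRegular (D : (ℝ → ℝ) → ℝ → ℝ) (N : ℕ) (q v : ℝ) (g f : ℝ → ℝ) : Prop where
  stein : ∀ x, x * f x - v * D f x = g x
  deriv_eq : deriv f = D f
  differentiable : ∀ k < N, Differentiable ℝ (D^[k] f)
  finite : {x | ¬ DifferentiableAt ℝ (D^[N] f) x}.Finite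
  primitive : ∀ k ≤ N, IsPrimitive (D^[k] f) (D^[k + 1] f)
  growth : ∀ k ≤ N, PolyGrowth ((N : ℝ) - k + q - 1) (D^[k] f)
  growth_top : PolyGrowth q (D^[N + 1] f)
  disc : {x | ¬ ContinuousAt (D^[N + 1] f) x}.Finite

section SteinDeriv

variable {N : ℕ} {q v : ℝ} {G : ℕ → ℝ → ℝ} {f : ℝ → ℝ}

theorem hasDerivAt_steinDeriv (hG : ∀ k < N, IsPrimitive (G k) (G (k + 1)))
    (hf : ∀ x, ContinuousAt (G 0) x → HasDerivAt f ((x * f x - G 0 x) / v) x) {k : ℕ} (hk : k ≤ N)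
    {x : ℝ} (hx : ContinuousAt (G k) x) :
    HasDerivAt (steinDeriv v f G k) (steinDeriv v f G (k + 1) x) x := by
  induction k using Nat.strong_induction_on with
  | _ k ih =>
    have hc (j : ℕ) (hj : j < N) : ContinuousAt (G j) x := (hG j hj).continuous.continuousAt
    match k, ih, hk, hx with
    | 0, _, _, hx => exact hf x hx
    | 1, ih, hk, hx =>
      have h0 := ih 0 Nat.zero_lt_one (Nat.zero_le _) (hc 0 hk)
      have := (((hasDerivAt_id x).mul h0).sub ((hG 0 hk).hasDerivAt hx)).div_const v
      refine this.congr_deriv ?_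
      simp only [steinDeriv, id, Nat.cast_zero]
      ring
    | k + 2, ih, hk, hx =>
      have h0 := ih k (by omega) (by omega) (hc k (by omega))
      have h1 := ih (k + 1) (by omega) (by omega) (hc (k + 1) (by omega))
      have := ((((hasDerivAt_id x).mul h1).add (h0.const_mul ((k : ℝ) + 1))).sub
        ((hG (k + 1) (by omega)).hasDerivAt hx)).div_const v
      refine this.congr_deriv ?_
      simp only [steinDeriv, id]
      push_cast
      ring

/-- A single formula for both clauses of the recursion: at `k = 0` the truncated index `k - 1`
carries the coefficient zero. -/
theorem steinDeriv_succ (k : ℕ) (x : ℝ) : steinDeriv v f G (k + 1) x =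
    (x * steinDeriv v f G k x + k * steinDeriv v f G (k - 1) x - G k x) / v := by
  cases k with
  | zero => simp [steinDeriv]
  | succ k => simp [steinDeriv]

/-- By induction on `k`: in the equation for the `k`-th derivative, `G k` and `k` times the previous
derivative both have growth `N - k + q`, and solving the equation gains one power. -/
theorem growth_steinDeriv (hv : 0 < v) (hq : 0 ≤ q) (hN : 0 < N)
    (hG : ∀ k < N, IsPrimitive (G k) (G (k + 1)))
    (hdisc : {x | ¬ ContinuousAt (G N) x}.Finite) (hgrowth : PolyGrowth q (G N))
    (hf : ∀ x, ContinuousAt (G 0) x → HasDerivAt f ((x * f x - G 0 x) / v) x)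
    (h0 : Tendsto (fun x => f x * Real.exp (-x ^ 2 / (2 * v))) (cocompact ℝ) (𝓝 0))
    {k : ℕ} (hk : k ≤ N) : PolyGrowth ((N : ℝ) - k + q - 1) (steinDeriv v f G k) := by
  have hc (j : ℕ) (hj : j < N) (x : ℝ) : ContinuousAt (G j) x :=
    (hG j hj).continuous.continuousAt
  have hcont (j : ℕ) (hj : j ≤ N) : Continuous (steinDeriv v f G j) := by
    cases j with
    | zero => exact continuous_iff_continuousAt.mpr fun x => (hf x (hc 0 hN x)).continuousAt
    | succ j =>
      cases j with
      | zero =>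
        have hfc : Continuous f :=
          continuous_iff_continuousAt.mpr fun x => (hf x (hc 0 hN x)).continuousAt
        exact ((continuous_id.mul hfc).sub (hG 0 hN).continuous).div_const v
      | succ j =>
        have h1 : Continuous (steinDeriv v f G (j + 1)) := continuous_iff_continuousAt.mpr
          fun x => (hasDerivAt_steinDeriv hG hf (by omega) (hc (j + 1) (by omega) x)).continuousAt
        have h2 : Continuous (steinDeriv v f G j) := continuous_iff_continuousAt.mpr
          fun x => (hasDerivAt_steinDeriv hG hf (by omega) (hc j (by omega) x)).continuousAt
        exact (((continuous_id.mul h1).add (continuous_const.mul h2)).sub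
          (hG (j + 1) (by omega)).continuous).div_const v
  induction k using Nat.strong_induction_on with
  | _ k ih =>
    have hrhs : PolyGrowth ((N : ℝ) - k + q)
        fun x => G k x - k * steinDeriv v f G (k - 1) x := by
      refine (polyGrowth_of_chain hq hG hgrowth hk).sub ?_
      rcases Nat.eq_zero_or_pos k with rfl | hk0
      · simpa using PolyGrowth.const 0 (by positivity)
      · refine PolyGrowth.const_mul _ ((ih (k - 1) (by omega) (by omega)).mono (le_of_eq ?_))
        rw [Nat.cast_pred hk0]
        ring
    refine PolyGrowth.of_stein hv hrhs (hcont k hk) (Set.Finite.subset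
      (s := {x | ¬ ContinuousAt (G k) x}) ?_ fun x hx hx' => hx ?_) ?_
    · rcases hk.lt_or_eq with hk | rfl
      · convert Set.finite_empty (α := ℝ)
        ext x
        simpa using hc k hk x
      · exact hdisc
    · refine (hasDerivAt_steinDeriv hG hf hk hx').congr_deriv ?_
      rw [steinDeriv_succ]
      ring
    · rcases Nat.eq_zero_or_pos k with rfl | hk0
      · exact h0
      · obtain ⟨j, rfl⟩ := Nat.exists_eq_succ_of_ne_zero hk0.ne'
        have hj : j < N := hk
        -- `PolyGrowth.of_stein` needs only decay against the Gaussian. The recursion supplies a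
        -- polynomial bound, one power worse than the one sought, and that suffices.
        refine PolyGrowth.tendsto_mul_gaussian (r := (N : ℝ) - j + q) ?_ hv
        have h1 := ((ih j (by omega) (by omega)).id_mul).mono (s := (N : ℝ) - j + q) (by linarith)
        have h2 := polyGrowth_of_chain hq hG hgrowth hj.le
        have h3 : PolyGrowth ((N : ℝ) - j + q)
            fun x => (j : ℝ) * steinDeriv v f G (j - 1) x := by
          rcases Nat.eq_zero_or_pos j with rfl | hj0
          · simpa using PolyGrowth.const 0 (by positivity)
          · refine PolyGrowth.const_mul _ ((ih (j - 1) (by omega) (by omega)).mono (le_of_eq ?_))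
            rw [Nat.cast_pred hj0]
            ring
        refine (((h1.add h3).sub h2).const_mul v⁻¹).congr_finite ?_
        convert Set.finite_empty (α := ℝ)
        ext x
        simp only [Set.mem_ofPred_eq, Set.mem_empty_iff_false, iff_false, not_not]
        rw [Nat.succ_eq_add_one, steinDeriv_succ]
        ring

theorem steinRegular_of_chain {D : (ℝ → ℝ) → ℝ → ℝ} (hD : IsDerivativeConvention D)
    (hv : 0 < v) (hq : 0 ≤ q) (hN : 0 < N)
    (hG : ∀ k < N, IsPrimitive (G k) (G (k + 1)))
    (hdisc : {x | ¬ ContinuousAt (G N) x}.Finite) (hgrowth : PolyGrowth q (G N))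
    (hf : ∀ x, ContinuousAt (G 0) x → HasDerivAt f ((x * f x - G 0 x) / v) x)
    (h0 : Tendsto (fun x => f x * Real.exp (-x ^ 2 / (2 * v))) (cocompact ℝ) (𝓝 0)) :
    SteinRegular D N q v (G 0) f := by
  have hc (j : ℕ) (hj : j < N) (x : ℝ) : ContinuousAt (G j) x :=
    (hG j hj).continuous.continuousAt
  have hder (k : ℕ) (hk : k ≤ N) (x : ℝ) (hx : ContinuousAt (G k) x) :=
    hasDerivAt_steinDeriv hG hf hk hx
  have hgr (k : ℕ) (hk : k ≤ N) := growth_steinDeriv hv hq hN hG hdisc hgrowth hf h0 hk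
  have hiter (k : ℕ) (hk : k ≤ N) : D^[k] f = steinDeriv v f G k := by
    induction k with
    | zero => rfl
    | succ k ih =>
      rw [Function.iterate_succ_apply', ih (by omega)]
      funext x
      have := hder k (by omega) x (hc k hk x)
      rw [hD _ x this.differentiableAt, this.deriv]
  have hcont (k : ℕ) (hk : k < N) : Continuous (steinDeriv v f G k) :=
    continuous_iff_continuousAt.mpr fun x => (hder k hk.le x (hc k hk x)).continuousAt
  have hcontN : Continuous (steinDeriv v f G N) := by
    obtain ⟨n, rfl⟩ := Nat.exists_eq_succ_of_ne_zero hN.ne'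
    have : steinDeriv v f G (n + 1) = fun x =>
        (x * steinDeriv v f G n x + n * steinDeriv v f G (n - 1) x - G n x) / v :=
      funext fun x => steinDeriv_succ n x
    rw [Nat.succ_eq_add_one, this]
    exact (((continuous_id.mul (hcont n (by omega))).add
      (continuous_const.mul (hcont (n - 1) (by omega)))).sub
        (hG n (by omega)).continuous).div_const v
  have htop (x : ℝ) (hx : ContinuousAt (G N) x) :
      D^[N + 1] f x = steinDeriv v f G (N + 1) x := by
    rw [Function.iterate_succ_apply', hiter N le_rfl]
    have := hder N le_rfl x hx
    rw [hD _ x this.differentiableAt, this.deriv]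
  have htopc (x : ℝ) (hx : ContinuousAt (G N) x) :
      ContinuousAt (steinDeriv v f G (N + 1)) x := by
    have : steinDeriv v f G (N + 1) = fun x =>
        (x * steinDeriv v f G N x + N * steinDeriv v f G (N - 1) x - G N x) / v :=
      funext fun x => steinDeriv_succ N x
    rw [this]
    exact (((continuous_id.mul hcontN).add
      (continuous_const.mul (hcont (N - 1) (by omega)))).continuousAt.sub hx).div_const v
  have hdisc' : {x | ¬ ContinuousAt (D^[N + 1] f) x}.Finite := by
    refine hdisc.subset fun x hx hx' => hx ?_
    refine (htopc x hx').congr ?_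
    -- The convention agrees with `steinDeriv` off a finite, hence closed, set, so they agree near
    -- every point where `G N` is continuous.
    filter_upwards [hdisc.isClosed.isOpen_compl.mem_nhds (fun h => h hx')] with y hy
    exact (htop y (by simpa using hy)).symm
  have hgtop : PolyGrowth q (D^[N + 1] f) := by
    -- The top derivative is read off from the equation, all three terms of which have growth `q`;
    -- no power is gained here.
    have h1 := (hgr N le_rfl).id_mul.mono (s := q) (by linarith)
    have h2 := ((hgr (N - 1) (by omega)).const_mul N).mono (s := q) (by
      rw [Nat.cast_pred hN]; linarith)
    refine (((h1.add h2).sub hgrowth).const_mul v⁻¹).congr_finite (hdisc.subset fun x hx hx' =>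
      hx ?_)
    rw [htop x hx', steinDeriv_succ]
    ring
  have h1 : D f = steinDeriv v f G 1 := hiter 1 hN
  have hd (k : ℕ) (hk : k ≤ N) (x : ℝ) (hx : ContinuousAt (G k) x) :
      HasDerivAt (D^[k] f) (D^[k + 1] f x) x := by
    have := hder k hk x hx
    rw [← hiter k hk] at this
    rcases hk.lt_or_eq with hk | rfl
    · rwa [hiter (k + 1) hk]
    · rwa [htop x hx]
  refine ⟨fun x => ?_, ?_, fun k hk x => ?_, ?_, fun k hk => ?_, fun k hk => ?_, hgtop, hdisc'⟩
  · rw [h1]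
    simp only [steinDeriv]
    field_simp
    ring
  · funext x
    exact (hd 0 (Nat.zero_le _) x (hc 0 hN x)).deriv
  · exact (hd k hk.le x (hc k hk x)).differentiableAt
  · exact hdisc.subset fun x hx hx' => hx (hd N le_rfl x hx').differentiableAt
  · rcases hk.lt_or_eq with hk | rfl
    · have hck : Continuous (D^[k + 1] f) := by
        rw [hiter (k + 1) hk]
        rcases (Nat.succ_le_of_lt hk).lt_or_eq with h | h
        · exact hcont _ h
        · rw [← Nat.succ_eq_add_one, h]; exact hcontN
      refine IsPrimitive.of_hasDerivAt_off_finite (by rw [hiter k hk.le]; exact hcont k hk)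
        Set.finite_empty (fun x _ => hd k hk.le x (hc k hk x))
        fun a b => hck.intervalIntegrable a b
    · refine IsPrimitive.of_hasDerivAt_off_finite (by rw [hiter k le_rfl]; exact hcontN)
        hdisc (fun x hx => hd k le_rfl x (by simpa using hx)) fun a b =>
          hgtop.intervalIntegrable (measurable_of_finite_discontinuities hdisc') a b
  · rw [hiter k hk]
    exact hgr k hk

end SteinDeriv

theorem FiniteOrderClass.integrable_gaussianReal {N : ℕ} {q : ℝ} {h : ℝ → ℝ} (hq : 0 ≤ q)
    (hh : FiniteOrderClass N q h) (v : NNReal) : Integrable h (gaussianReal 0 v) :=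
  (hh.polyGrowth hq).integrable_comp (Y := id) hh.measurable (by positivity) le_rfl
    (memLp_id_gaussianReal' _ ENNReal.ofReal_ne_top)

theorem FiniteOrderClass.steinRegular {D : (ℝ → ℝ) → ℝ → ℝ} (hD : IsDerivativeConvention D)
    {N : ℕ} {q : ℝ} {h : ℝ → ℝ} {v : NNReal} (hv : v ≠ 0) (hq : 0 ≤ q) (hN : 0 < N)
    (hh : FiniteOrderClass N q h) :
    SteinRegular D N q v (fun x => h x - normalExp v h) (steinSol v h) := by
  have hint := hh.integrable_gaussianReal hq v
  have hv0 : (0 : ℝ) < v := NNReal.coe_pos.mpr (pos_iff_ne_zero.mpr hv)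
  obtain ⟨H, rfl, hH, hdisc, hgr⟩ := hh
  obtain ⟨n, rfl⟩ := Nat.exists_eq_succ_of_ne_zero hN.ne'
  -- Centering changes only the function itself, since the constant disappears on differentiation.
  let G : ℕ → ℝ → ℝ
    | 0 => fun x => H 0 x - normalExp v (H 0)
    | k + 1 => H (k + 1)
  refine steinRegular_of_chain (G := G) hD hv0 hq hN (fun k hk => ?_) hdisc hgr
    (fun x _ => hasDerivAt_steinSol hv hint (hH 0 hN).continuous.continuousAt)
    (tendsto_steinSol_mul_gaussian hv hint)
  cases k with
  | zero =>
    refine ⟨(hH 0 hk).1, fun x => ?_⟩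
    simp only [G]
    rw [(hH 0 hk).2 x]
    ring
  | succ k => exact hH _ hk

/-- The class is stable under the recursion with `q` unchanged: the chain for `f^(s+1)` ends at the
same top derivative `f^(N+1)` for every `s`. -/
theorem SteinRegular.finiteOrderClass {D : (ℝ → ℝ) → ℝ → ℝ} {N : ℕ} {q v : ℝ} {g f : ℝ → ℝ}
    (hf : SteinRegular D N q v g f) {s : ℕ} (hs : s ≤ N) :
    FiniteOrderClass (N - s) q (D^[s + 1] f) := by
  refine ⟨fun k => D^[k + (s + 1)] f, by simp, fun k hk => ?_, ?_, ?_⟩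
  · have := hf.primitive (k + (s + 1)) (by omega)
    rwa [show k + (s + 1) + 1 = k + 1 + (s + 1) by ring] at this
  · simpa only [show N - s + (s + 1) = N + 1 by omega] using hf.disc
  · simpa only [show N - s + (s + 1) = N + 1 by omega] using hf.growth_top

theorem SteinRegular.derivativesExist {D : (ℝ → ℝ) → ℝ → ℝ} {N : ℕ} {q v : ℝ} {g f : ℝ → ℝ}
    (hf : SteinRegular D N q v g f) : DerivativesExist D N f :=
  ⟨hf.differentiable, hf.finite, hf.primitive N le_rfl⟩

/-! ### The space `H^N_{α,p}` -/

theorem IsNthDerivative.exists_chain {N : ℕ} {h g : ℝ → ℝ} (hg : IsNthDerivative N h g) :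
    ∃ H : ℕ → ℝ → ℝ, H 0 = h ∧ (∀ k < N, IsPrimitive (H k) (H (k + 1))) ∧ H N = g := by
  induction N generalizing h with
  | zero => exact ⟨fun _ => h, rfl, by simp, hg.symm⟩
  | succ N ih =>
    obtain ⟨h', h1, h2⟩ := hg
    obtain ⟨H, hH0, hH, hHN⟩ := ih h2
    refine ⟨fun k => k.casesOn h H, rfl, fun k hk => ?_, hHN⟩
    cases k with
    | zero => simpa [hH0] using h1
    | succ k => exact hH k (by omega)

theorem polyGrowth_of_alphaPNorm_lt_top {α p : ℝ} (hα : 0 < α) (hp : 0 ≤ p) {f : ℝ → ℝ}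
    (h0 : f 0 = 0) (hf : alphaPNorm α p f < ⊤) : PolyGrowth (α + p) f := by
  refine ⟨(alphaPNorm α p f).toReal * 3, fun x => ?_⟩
  rcases eq_or_ne x 0 with rfl | hx
  · rw [h0, abs_zero]
    positivity
  have h1 : ENNReal.ofReal (|f x - f 0| / (|x - 0| ^ α * (1 + |x| ^ p + |(0 : ℝ)| ^ p))) ≤
      alphaPNorm α p f := by
    unfold alphaPNorm
    exact le_iSup_of_le x (le_iSup_of_le 0 (le_iSup_of_le hx le_rfl))
  rw [ENNReal.ofReal_le_iff_le_toReal hf.ne, h0, sub_zero, sub_zero] at h1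
  have hx0 : 0 < |x| := abs_pos.mpr hx
  have hpos : 0 < |x| ^ α * (1 + |x| ^ p + |(0 : ℝ)| ^ p) := by positivity
  rw [div_le_iff₀ hpos] at h1
  refine h1.trans ?_
  rw [mul_assoc]
  refine mul_le_mul_of_nonneg_left ?_ ENNReal.toReal_nonneg
  have hX := one_add_abs_pos x
  have h2 : |x| ^ α ≤ (1 + |x|) ^ α := by gcongr; linarith
  have h3 : |x| ^ p ≤ (1 + |x|) ^ p := by gcongr; linarith
  have h4 : |(0 : ℝ)| ^ p ≤ (1 + |x|) ^ p := by gcongr; simpa using hX.le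
  have h5 : 1 ≤ (1 + |x|) ^ p := Real.one_le_rpow (one_le_one_add_abs x) hp
  calc |x| ^ α * (1 + |x| ^ p + |(0 : ℝ)| ^ p)
      ≤ (1 + |x|) ^ α * ((1 + |x|) ^ p + (1 + |x|) ^ p + (1 + |x|) ^ p) := by gcongr
    _ = 3 * (1 + |x|) ^ (α + p) := by rw [Real.rpow_add hX]; ring

theorem exists_bound_of_locallyBoundedVariationOn {g : ℝ → ℝ}
    (hg : LocallyBoundedVariationOn g Set.univ) (R : ℝ) : ∃ B, ∀ x, |x| ≤ R → |g x| ≤ B := by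
  have h := hg (-|R|) |R| trivial trivial
  have h0 : (0 : ℝ) ∈ Set.univ ∩ Set.Icc (-|R|) |R| := ⟨trivial, by simp⟩
  refine ⟨|g 0| + (eVariationOn g (Set.univ ∩ Set.Icc (-|R|) |R|)).toReal, fun x hx => ?_⟩
  have hx' : x ∈ Set.univ ∩ Set.Icc (-|R|) |R| :=
    ⟨trivial, abs_le.mp (hx.trans (le_abs_self R))⟩
  have h1 := eVariationOn.edist_le g hx' h0
  rw [edist_dist, ENNReal.ofReal_le_iff_le_toReal h, Real.dist_eq] at h1
  have := abs_sub_abs_le_abs_sub (g x) (g 0)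
  linarith

/-- Beyond the last jump on either side the function is constant. -/
theorem IsPureJump.polyGrowth_zero {g : ℝ → ℝ} (hg : IsPureJump g)
    (hb : ∀ R, ∃ B, ∀ x, |x| ≤ R → |g x| ≤ B) : PolyGrowth 0 g := by
  obtain ⟨S, hS⟩ := hg
  obtain ⟨R, hR⟩ := S.finite_toSet.isCompact.isBounded.exists_norm_le
  refine PolyGrowth.of_bounded (R := |R| + 1) (C := max |g (|R| + 1)| |g (-(|R| + 1))|)
    (hb _) fun x hx => ?_
  have hSR (s : ℝ) (hs : s ∈ S) : |s| < |R| + 1 := by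
    have := hR s hs
    rw [Real.norm_eq_abs] at this
    linarith [le_abs_self R]
  rw [Real.rpow_zero, mul_one]
  rcases le_total 0 x with h | h
  · rw [abs_of_nonneg h] at hx
    rw [← hS _ x hx fun s hs hs' => absurd (hSR s hs) (not_lt.mpr (hs'.1.trans (le_abs_self s)))]
    exact le_max_left _ _
  · rw [abs_of_nonpos h] at hx
    rw [hS x (-(|R| + 1)) (by linarith) fun s hs hs' => absurd (hSR s hs)
      (not_lt.mpr (le_trans (by linarith [hs'.2]) (neg_le_abs s)))]
    exact le_max_right _ _

/-- The `N`-th derivative is its continuous part, of growth `α + p`, plus a bounded jump part.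
Finite variation enters through the local bound on the jump part. -/
theorem MemH.finiteOrderClass {N : ℕ} {α p : ℝ} (hα : 0 < α) (hp : 0 ≤ p) {h : ℝ → ℝ}
    (hh : MemH N α p h) : FiniteOrderClass N (α + p) h := by
  obtain ⟨-, g, hg, hbv, hdisc, gc, ⟨hgc, -, hgc0, hjump⟩, hnorm⟩ := hh
  obtain ⟨H, hH0, hH, rfl⟩ := hg.exists_chain
  refine ⟨H, hH0, hH, hdisc, ?_⟩
  have h1 := polyGrowth_of_alphaPNorm_lt_top hα hp hgc0 hnorm
  have h2 := (hjump.polyGrowth_zero fun R => by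
    obtain ⟨B, hB⟩ := exists_bound_of_locallyBoundedVariationOn hbv R
    obtain ⟨B', hB'⟩ := (isCompact_Icc (a := -R) (b := R)).exists_bound_of_continuousOn
      hgc.continuousOn
    refine ⟨B + B', fun x hx => (abs_sub _ _).trans (add_le_add (hB x hx) ?_)⟩
    exact hB' x (abs_le.mp hx)).mono (s := α + p) (by positivity)
  simpa using h2.add h1


/-! ### Moments of random variables and the zero bias identity with an independent summand -/

section Probability

variable {Ω : Type*} [MeasurableSpace Ω] {P : Measure Ω}

theorem memLp_of_integrable_abs_rpow {Y : Ω → ℝ} (hY : Measurable Y) {M : ℝ} (hM : 0 ≤ M)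
    (h : Integrable (fun ω => |Y ω| ^ M) P) : MemLp Y (ENNReal.ofReal M) P := by
  rcases hM.eq_or_lt with rfl | hM0
  · simpa using hY.aestronglyMeasurable
  · rw [← integrable_norm_rpow_iff hY.aestronglyMeasurable (by simpa using hM0)
      ENNReal.ofReal_ne_top, ENNReal.toReal_ofReal hM]
    exact h

variable [IsProbabilityMeasure P]

theorem integrable_pow_of_memLp {Y : Ω → ℝ} {M : ℝ} (hY : MemLp Y (ENNReal.ofReal M) P) {k : ℕ}
    (hk : (k : ℝ) ≤ M) : Integrable (fun ω => Y ω ^ k) P := by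
  have hg : PolyGrowth k fun x => x ^ k := by
    refine ⟨1, fun x => ?_⟩
    rw [one_mul, Real.rpow_natCast, abs_pow]
    gcongr
    linarith
  exact hg.integrable_comp (measurable_id.pow_const k) ((Nat.cast_nonneg k).trans hk) hk hY

theorem memLp_ofReal_mono {Y : Ω → ℝ} {M M' : ℝ} (hY : MemLp Y (ENNReal.ofReal M) P)
    (h : M' ≤ M) : MemLp Y (ENNReal.ofReal M') P :=
  hY.mono_exponent (ENNReal.ofReal_le_ofReal h)

/-- The zero bias identity in the presence of an independent summand. -/
theorem integral_mul_eq_of_isZeroBias {V Y Ys : Ω → ℝ} (hV : Measurable V) (hY : Measurable Y)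
    (hYs : Measurable Ys) (hVY : IndepFun V Y P) (hVYs : IndepFun V Ys P)
    (hzb : IsZeroBias (P.map Y) (P.map Ys)) {f : ℝ → ℝ} (hf : Differentiable ℝ f)
    (h1 : Integrable (fun ω => Y ω * f (V ω + Y ω)) P)
    (h2 : Integrable (fun ω => deriv f (V ω + Ys ω)) P) :
    ∫ ω, Y ω * f (V ω + Y ω) ∂P = variance Y P * ∫ ω, deriv f (V ω + Ys ω) ∂P := by
  have hfm : Measurable f := hf.continuous.measurable
  have e1 := (indepFun_iff_map_prod_eq_prod_map_map hV.aemeasurable hY.aemeasurable).mp hVY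
  have e2 := (indepFun_iff_map_prod_eq_prod_map_map hV.aemeasurable hYs.aemeasurable).mp hVYs
  have m1 : Measurable fun q : ℝ × ℝ => q.2 * f (q.1 + q.2) := by fun_prop
  have m2 : Measurable fun q : ℝ × ℝ => deriv f (q.1 + q.2) :=
    (measurable_deriv f).comp (by fun_prop)
  have := Measure.isProbabilityMeasure_map (μ := P) hV.aemeasurable
  have := Measure.isProbabilityMeasure_map (μ := P) hY.aemeasurable
  have := Measure.isProbabilityMeasure_map (μ := P) hYs.aemeasurable
  have i1 : Integrable (fun q : ℝ × ℝ => q.2 * f (q.1 + q.2)) ((P.map V).prod (P.map Y)) := by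
    rw [← e1, integrable_map_measure m1.aestronglyMeasurable (hV.prodMk hY).aemeasurable]
    exact h1
  have i2 : Integrable (fun q : ℝ × ℝ => deriv f (q.1 + q.2)) ((P.map V).prod (P.map Ys)) := by
    rw [← e2, integrable_map_measure m2.aestronglyMeasurable (hV.prodMk hYs).aemeasurable]
    exact h2
  have t1 : ∫ ω, Y ω * f (V ω + Y ω) ∂P =
      ∫ w, ∫ y, y * f (w + y) ∂(P.map Y) ∂(P.map V) := by
    rw [← integral_prod _ i1, ← e1, integral_map (hV.prodMk hY).aemeasurable
      m1.aestronglyMeasurable]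
  have t2 : ∫ ω, deriv f (V ω + Ys ω) ∂P =
      ∫ w, ∫ y, deriv f (w + y) ∂(P.map Ys) ∂(P.map V) := by
    rw [← integral_prod _ i2, ← e2, integral_map (hV.prodMk hYs).aemeasurable
      m2.aestronglyMeasurable]
  have hvar : variance (fun x : ℝ => x) (P.map Y) = variance Y P := variance_id_map hY.aemeasurable
  rw [t1, t2, ← integral_const_mul]
  refine integral_congr_ae ?_
  -- By Fubini, for almost every value `w` of `V`, the translate `x ↦ f (w + x)` satisfies both
  -- integrability conditions of the zero bias identity.
  filter_upwards [i1.prod_right_ae, i2.prod_right_ae] with w hw1 hw2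
  have hd : deriv (fun x => f (w + x)) = fun x => deriv f (w + x) :=
    funext fun x => deriv_comp_const_add f w x
  have := hzb (fun x => f (w + x)) (hf.comp (differentiable_id.const_add w)) hw1
    (by rw [hd]; exact hw2)
  rw [this, hvar, hd]

section ZeroBias

variable {Y : Ω → ℝ} {M : ℝ}

theorem zeroBias_hypotheses (hY : Measurable Y) (hM : 2 ≤ M)
    (hYM : MemLp Y (ENNReal.ofReal M) P) (hmean : ∫ ω, Y ω ∂P = 0) (hvar : 0 < variance Y P) :
    Integrable (fun x : ℝ => x) (P.map Y) ∧ Integrable (fun x : ℝ => x ^ 2) (P.map Y) ∧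
      ∫ x, x ∂(P.map Y) = 0 ∧
      variance (fun x : ℝ => x) (P.map Y) = ∫ x, x ^ 2 ∂(P.map Y) ∧
      0 < ∫ x, x ^ 2 ∂(P.map Y) := by
  have hYp {k : ℕ} (hk : (k : ℝ) ≤ M) : Integrable (fun x : ℝ => x ^ k) (P.map Y) := by
    rw [integrable_map_measure (by fun_prop) hY.aemeasurable]
    exact integrable_pow_of_memLp hYM hk
  have h1 : Integrable (fun x : ℝ => x) (P.map Y) := by
    simpa using hYp (k := 1) (by push_cast; linarith)
  have hm : ∫ x, x ∂(P.map Y) = 0 := by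
    rw [integral_map hY.aemeasurable (by fun_prop)]
    exact hmean
  have hvar' : variance (fun x : ℝ => x) (P.map Y) = variance Y P := variance_id_map hY.aemeasurable
  have hsq : variance (fun x : ℝ => x) (P.map Y) = ∫ x, x ^ 2 ∂(P.map Y) :=
    variance_of_integral_eq_zero (by fun_prop) hm
  exact ⟨h1, hYp (by exact_mod_cast hM), hm, hsq, by rwa [← hsq, hvar']⟩

theorem existsUnique_zeroBias_map (hY : Measurable Y) (hM : 2 ≤ M)
    (hYM : MemLp Y (ENNReal.ofReal M) P) (hmean : ∫ ω, Y ω ∂P = 0) (hvar : 0 < variance Y P) :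
    ∃! ν : Measure ℝ, IsProbabilityMeasure ν ∧ IsZeroBias (P.map Y) ν := by
  have := Measure.isProbabilityMeasure_map (μ := P) hY.aemeasurable
  obtain ⟨h1, h2, hm, hsq, hpos⟩ := zeroBias_hypotheses hY hM hYM hmean hvar
  exact existsUnique_isZeroBias h2 hpos hsq h1 hm

/-- Uniqueness identifies the law of `Ys` with the explicit construction, from which the moments are
read. -/
theorem memLp_of_isZeroBias {Ys : Ω → ℝ} (hY : Measurable Y) (hYs : Measurable Ys)
    (hM : 2 ≤ M) (hYM : MemLp Y (ENNReal.ofReal M) P) (hmean : ∫ ω, Y ω ∂P = 0)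
    (hvar : 0 < variance Y P) (hzb : IsZeroBias (P.map Y) (P.map Ys)) :
    MemLp Ys (ENNReal.ofReal (M - 2)) P := by
  have := Measure.isProbabilityMeasure_map (μ := P) hY.aemeasurable
  have := Measure.isProbabilityMeasure_map (μ := P) hYs.aemeasurable
  obtain ⟨h1, h2, hm, hsq, hpos⟩ := zeroBias_hypotheses hY hM hYM hmean hvar
  have hlaw : P.map Ys = zeroBias (P.map Y) :=
    have := isProbabilityMeasure_zeroBias h2 hpos
    hzb.unique h2 (hsq ▸ hpos) (isZeroBias_zeroBias h2 hpos hsq h1 hm)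
  have hm (r : ℝ) : Measurable fun x : ℝ => |x| ^ r := by fun_prop
  have hr : Integrable (fun x : ℝ => |x| ^ (M - 2)) (P.map Ys) := by
    rw [hlaw]
    refine integrable_rpow_zeroBias h2 hpos (by linarith) ?_
    rw [integrable_map_measure (hm _).aestronglyMeasurable hY.aemeasurable, sub_add_cancel]
    have := hYM.integrable_norm_rpow'
    rwa [ENNReal.toReal_ofReal (by linarith)] at this
  refine memLp_of_integrable_abs_rpow hYs (by linarith) ?_
  rwa [integrable_map_measure (hm _).aestronglyMeasurable hYs.aemeasurable] at hr

end ZeroBias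

end Probability

/-! ### Stein's identity for the sum and the expansion -/

section Sums

variable {Ω : Type*} {n : ℕ}

theorem sumWithout_add (X : Fin n → Ω → ℝ) (i : Fin n) (ω : Ω) :
    sumWithout X i ω + X i ω = sumW X ω := sub_add_cancel _ _

theorem sumWithout_eq_sum_erase (X : Fin n → Ω → ℝ) (i : Fin n) :
    sumWithout X i = ∑ j ∈ Finset.univ.erase i, X j := by
  funext ω
  rw [sumWithout, sumW, ← Finset.add_sum_erase _ _ (Finset.mem_univ i), Finset.sum_apply]
  ring

variable [MeasurableSpace Ω] {P : Measure Ω} {X Xs : Fin n → Ω → ℝ}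

theorem memLp_sumW {p : ENNReal} (hX : ∀ i, MemLp (X i) p P) : MemLp (sumW X) p P :=
  memLp_finsetSum _ fun i _ => hX i

theorem measurable_sumW (hX : ∀ i, Measurable (X i)) : Measurable (sumW X) :=
  Finset.measurable_fun_sum _ fun i _ => hX i

theorem coe_varW (hX2 : ∀ i, MemLp (X i) 2 P) (hindep : iIndepFun X P) :
    (varW P X : ℝ) = ∑ i, variance (X i) P := by
  rw [varW, Real.coe_toNNReal _ (variance_nonneg _ _)]
  have : sumW X = ∑ i, X i := by
    funext ω
    simp [sumW]
  rw [this]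
  exact IndepFun.variance_sum (fun i _ => hX2 i) fun i _ j _ hij => hindep.indepFun hij

variable [IsProbabilityMeasure P]

/-- Stein's identity combined with the zero bias transformation. -/
theorem SteinRegular.integral_sub_eq_sum {D : (ℝ → ℝ) → ℝ → ℝ} {N : ℕ} {q M v : ℝ}
    {g f : ℝ → ℝ} (hf : SteinRegular D N q v g f) (hq : 0 ≤ q) (hN : 0 < N)
    (hM : (N : ℝ) + q ≤ M) (hM2 : (N : ℝ) + 2 ≤ M)
    (hXmeas : ∀ i, Measurable (X i)) (hindep : iIndepFun X P)
    (hX : ∀ i, MemLp (X i) (ENNReal.ofReal M) P)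
    (hv : v = ∑ i, variance (X i) P)
    (hXsmeas : ∀ i, Measurable (Xs i)) (hXs : ∀ i, MemLp (Xs i) (ENNReal.ofReal (M - 2)) P)
    (hzb : ∀ i, IsZeroBias (P.map (X i)) (P.map (Xs i)))
    (hXsindep : ∀ i, IndepFun (Xs i) (sumWithout X i) P) :
    Integrable (fun ω => g (sumW X ω)) P ∧
    (∀ i, Integrable (fun ω => D f (sumWithout X i ω + Xs i ω)) P) ∧
    ∫ ω, g (sumW X ω) ∂P = ∑ i, variance (X i) P *
      (∫ ω, D f (sumWithout X i ω + Xs i ω) ∂P -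
        ∫ ω, D f (sumWithout X i ω + X i ω) ∂P) := by
  have hN1 : (1 : ℝ) ≤ N := by exact_mod_cast hN
  have hfd : Differentiable ℝ f := hf.differentiable 0 hN
  have hfg : PolyGrowth ((N : ℝ) + q - 1) f := by simpa using hf.growth 0 (Nat.zero_le N)
  -- This exponent is what the `M - 2` moments of `Xs i` allow, since `N + q ≤ M`.
  have hDg : PolyGrowth ((N : ℝ) + q - 2) (D f) :=
    (hf.growth 1 hN).mono (by push_cast; linarith)
  have hDm : Measurable (D f) := hf.deriv_eq ▸ measurable_deriv f
  have hW := memLp_sumW hX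
  have hWi (i) : MemLp (sumWithout X i) (ENNReal.ofReal M) P := hW.sub (hX i)
  have hWim (i) : Measurable (sumWithout X i) := (measurable_sumW hXmeas).sub (hXmeas i)
  have hindepi (i) : IndepFun (sumWithout X i) (X i) P := by
    rw [sumWithout_eq_sum_erase]
    exact hindep.indepFun_finsetSum_of_notMem hXmeas (Finset.notMem_erase i _)
  have i1 (i) : Integrable (fun ω => D f (sumWithout X i ω + Xs i ω)) P :=
    hDg.integrable_comp hDm (by linarith) (by linarith)
      ((memLp_ofReal_mono (hWi i) (by linarith)).add (hXs i))
  have i2 : Integrable (fun ω => D f (sumW X ω)) P :=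
    hDg.integrable_comp hDm (by linarith) (by linarith) hW
  -- `X i` and the sum are dependent, so both are dominated by `|X i| + |sumW X|`. The product is
  -- then at most the power `N + q` of one plus this variable, times `C`.
  have i3 (i) : Integrable (fun ω => X i ω * f (sumW X ω)) P := by
    obtain ⟨C, hC0, hC⟩ := hfg.exists_nonneg
    have hZ : MemLp (fun ω => |X i ω| + |sumW X ω|) (ENNReal.ofReal M) P :=
      (hX i).abs.add hW.abs
    have hZi : Integrable (fun ω => C * (1 + |(|X i ω| + |sumW X ω|)|) ^ ((N : ℝ) + q)) P := by
      refine PolyGrowth.integrable_comp (r := (N : ℝ) + q) (f := fun x => C * (1 + |x|) ^ ((N : ℝ) + q))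
        ⟨C, fun x => ?_⟩ ?_ (by linarith) hM hZ
      · rw [abs_of_nonneg]
        have := rpow_one_add_abs_pos ((N : ℝ) + q) x
        positivity
      · fun_prop
    refine hZi.mono' ((hXmeas i).mul (hfd.continuous.measurable.comp
      (measurable_sumW hXmeas))).aestronglyMeasurable (ae_of_all _ fun ω => ?_)
    have hpos : 0 < 1 + |(|X i ω| + |sumW X ω|)| := one_add_abs_pos _
    have e : (1 + |(|X i ω| + |sumW X ω|)|) ^ ((N : ℝ) + q) =
        (1 + |(|X i ω| + |sumW X ω|)|) ^ ((N : ℝ) + q - 1) * (1 + |(|X i ω| + |sumW X ω|)|) := by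
      rw [← Real.rpow_add_one hpos.ne']
      congr 1
      ring
    have ha : |(|X i ω| + |sumW X ω|)| = |X i ω| + |sumW X ω| :=
      abs_of_nonneg (by positivity)
    rw [norm_mul, Real.norm_eq_abs, Real.norm_eq_abs, e, ← mul_assoc, mul_comm |X i ω|]
    have h0 : 0 ≤ (N : ℝ) + q - 1 := by linarith
    have h1 := abs_nonneg (X i ω)
    have h2 := abs_nonneg (sumW X ω)
    refine mul_le_mul ((hC _).trans ?_) (by rw [ha]; linarith) h1 (by positivity)
    refine mul_le_mul_of_nonneg_left (Real.rpow_le_rpow (one_add_abs_pos _).le ?_ h0) hC0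
    rw [ha]
    linarith
  have hzbi (i) : ∫ ω, X i ω * f (sumW X ω) ∂P =
      variance (X i) P * ∫ ω, D f (sumWithout X i ω + Xs i ω) ∂P := by
    have := integral_mul_eq_of_isZeroBias (hWim i) (hXmeas i) (hXsmeas i) (hindepi i)
      (hXsindep i).symm (hzb i) hfd (by simpa only [sumWithout_add] using i3 i)
      (by simpa only [hf.deriv_eq] using i1 i)
    simpa only [sumWithout_add, hf.deriv_eq] using this
  have hsum (ω) : g (sumW X ω) = ∑ i, X i ω * f (sumW X ω) - v * D f (sumW X ω) := by
    rw [← hf.stein, ← Finset.sum_mul]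
    rfl
  have i4 : Integrable (fun ω => ∑ i, X i ω * f (sumW X ω)) P :=
    integrable_finsetSum _ fun i _ => i3 i
  simp only [hsum]
  refine ⟨i4.sub (i2.const_mul v), i1, ?_⟩
  rw [integral_sub i4 (i2.const_mul v), integral_finsetSum _ fun i _ => i3 i, integral_const_mul,
    hv, Finset.sum_mul, ← Finset.sum_sub_distrib]
  refine Finset.sum_congr rfl fun i _ => ?_
  rw [hzbi i]
  simp only [sumWithout_add]
  ring

/-- The expansion for functions whose `N`-th derivative has finitely many discontinuities and
polynomial growth. -/
theorem FiniteOrderClass.expansion {D : (ℝ → ℝ) → ℝ → ℝ} (hD : IsDerivativeConvention D)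
    {q M : ℝ} (hq : 0 ≤ q) (hn : 0 < n)
    (hXmeas : ∀ i, Measurable (X i)) (hindep : iIndepFun X P)
    (hX : ∀ i, MemLp (X i) (ENNReal.ofReal M) P) (hXvar : ∀ i, 0 < variance (X i) P)
    (hXsmeas : ∀ i, Measurable (Xs i)) (hXs : ∀ i, MemLp (Xs i) (ENNReal.ofReal (M - 2)) P)
    (hzb : ∀ i, IsZeroBias (P.map (X i)) (P.map (Xs i)))
    (hXsindep : ∀ i, IndepFun (Xs i) (sumWithout X i) P)
    {N : ℕ} (hM : (N : ℝ) + q ≤ M) (hM2 : (N : ℝ) + 2 ≤ M) {h : ℝ → ℝ}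
    (hh : FiniteOrderClass N q h) :
    MainTermWellDefined D P X Xs N h ∧ ErrorTermWellDefined D P X Xs N h ∧
      Integrable (fun ω => h (sumW X ω)) P ∧
      ∫ ω, h (sumW X ω) ∂P = mainTerm D P X Xs N h + errorTerm D P X Xs N h := by
  induction N using Nat.strong_induction_on generalizing h with
  | _ N ih =>
  have hM0 : 0 ≤ M := by linarith [(Nat.cast_nonneg N : (0 : ℝ) ≤ N)]
  have hG := hh.integrable_gaussianReal hq (varW P X)
  have hW := memLp_sumW hX
  have hWint : Integrable (fun ω => h (sumW X ω)) P :=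
    (hh.polyGrowth hq).integrable_comp hh.measurable hM0 hM hW
  rcases N with _ | N
  · rw [MainTermWellDefined, ErrorTermWellDefined, mainTerm, errorTerm]
    exact ⟨hG, ⟨hWint, hG⟩, hWint, by ring⟩
  have hcv := coe_varW (fun i => (hX i).mono_exponent (by
    rw [← ENNReal.ofReal_ofNat 2]
    exact ENNReal.ofReal_le_ofReal
      (by linarith [(Nat.cast_nonneg (N + 1) : (0 : ℝ) ≤ ((N + 1 : ℕ) : ℝ))]))) hindep
  have hv : varW P X ≠ 0 := by
    have : 0 < (varW P X : ℝ) := by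
      rw [hcv]
      have : Nonempty (Fin n) := ⟨⟨0, hn⟩⟩
      exact Finset.sum_pos (fun i _ => hXvar i) Finset.univ_nonempty
    exact (NNReal.coe_pos.mp this).ne'
  have hS := hh.steinRegular hD hv hq N.succ_pos
  obtain ⟨-, hint, hid⟩ := hS.integral_sub_eq_sum hq N.succ_pos hM hM2 hXmeas hindep hX hcv
    hXsmeas hXs hzb hXsindep
  set f := steinSol (varW P X) h with hfdef
  -- `M` stays fixed while the order drops by `s`, so the moment conditions only become weaker.
  have hIH (s : ℕ) (hs1 : 1 ≤ s) (hs : s ≤ N + 1) :=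
    ih (N + 1 - s) (by omega) (by
      refine le_trans ?_ hM
      have : ((N + 1 - s : ℕ) : ℝ) ≤ ((N + 1 : ℕ) : ℝ) := by exact_mod_cast Nat.sub_le _ _
      linarith) (by
      refine le_trans ?_ hM2
      have : ((N + 1 - s : ℕ) : ℝ) ≤ ((N + 1 : ℕ) : ℝ) := by exact_mod_cast Nat.sub_le _ _
      linarith) (hS.finiteOrderClass hs)
  have hwd : SteinSolWellDefined (varW P X) h := steinSolWellDefined hv hG
  have hmom (i) (k : ℕ) (hk : k ≤ N + 1) :
      Integrable (fun ω => X i ω ^ k) P ∧ Integrable (fun ω => Xs i ω ^ k) P := by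
    have hk' : (k : ℝ) ≤ ((N + 1 : ℕ) : ℝ) := by exact_mod_cast hk
    exact ⟨integrable_pow_of_memLp (hX i) (by linarith),
      integrable_pow_of_memLp (hXs i) (by linarith)⟩
  have hiter {Y : Ω → ℝ} (hY : MemLp Y (ENNReal.ofReal M) P) (k : ℕ) (hk : k ≤ N + 2) :
      Integrable (fun ω => (D^[k] f) (Y ω)) P := by
    rcases hk.lt_or_eq with hk | rfl
    · refine (hS.growth k (by omega)).integrable_comp ?_ hM0 ?_ hY
      · exact (hS.primitive k (by omega)).continuous.measurable
      · have : (0 : ℝ) ≤ k := k.cast_nonneg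
        linarith
    -- At the top order there is no continuity, so measurability comes from the finiteness of the
    -- set of discontinuities.
    · refine hS.growth_top.integrable_comp (measurable_of_finite_discontinuities hS.disc) hM0 ?_ hY
      linarith [(Nat.cast_nonneg (N + 1) : (0 : ℝ) ≤ ((N + 1 : ℕ) : ℝ))]
  have hWi (i) : MemLp (sumWithout X i) (ENNReal.ofReal M) P := hW.sub (hX i)
  refine ⟨?_, ?_, hWint, ?_⟩
  · rw [MainTermWellDefined]
    exact ⟨hwd, hS.derivativesExist, hmom, fun s hs1 hs => (hIH s hs1 hs).1⟩
  · rw [ErrorTermWellDefined]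
    refine ⟨hwd, hS.derivativesExist, hmom, fun s hs1 hs => (hIH s hs1 hs).2.1,
      fun i k hk s hs => ⟨(hmom i s (by omega)).1, ?_, fun k' hk' => ⟨(hmom i k' (by omega)).1, ?_⟩⟩,
      fun i => ⟨hint i, fun k hk => ⟨(hmom i k hk).2, ?_⟩⟩⟩
    · rw [← hfdef, ← Function.iterate_add_apply]
      simp only [sumWithout_add]
      exact hiter hW _ (by omega)
    · rw [← hfdef, ← Function.iterate_add_apply, ← Function.iterate_add_apply]
      exact hiter (hWi i) _ (by omega)
    · rw [← hfdef, ← Function.iterate_succ_apply]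
      exact hiter (hWi i) _ (by omega)
  · rw [mainTerm, errorTerm, add_assoc, ← Finset.sum_add_distrib]
    rw [integral_sub hWint (integrable_const _), integral_const] at hid
    simp only [probReal_univ, one_smul] at hid
    rw [sub_eq_iff_eq_add'] at hid
    rw [hid]
    congr 1
    refine Finset.sum_congr rfl fun i _ => ?_
    -- The expansion is applied to `f'` at the full order. Its remainders are those of the error
    -- term, and the expectations at `W` that remain are split by the induction hypothesis.
    rw [← mul_add, integral_sub_integral_eq_expansion D P (N + 1) (D f), ← add_assoc, ← add_assoc]
    congr 3
    rw [← Finset.sum_add_distrib, ← Finset.sum_attach (Finset.Icc 1 (N + 1))]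
    refine Finset.sum_congr rfl fun s _ => ?_
    rw [← Finset.sum_add_distrib]
    refine Finset.sum_congr rfl fun c _ => ?_
    obtain ⟨hs1, hs⟩ := Finset.mem_Icc.mp s.2
    rw [← mul_add, ← (hIH s hs1 hs).2.2.2]
    simp only [sumWithout_add, Function.iterate_succ_apply]

end Sums

/-! ### The theorem -/

theorem theorem3p5 {Ω : Type*} [MeasurableSpace Ω] (P : Measure Ω) [IsProbabilityMeasure P]
    {n : ℕ} (hn : 0 < n) (N : ℕ) (α p : ℝ) (hα0 : 0 < α) (hα1 : α ≤ 1) (hp : 0 ≤ p)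
    (h : ℝ → ℝ) (hh : MemH N α p h)
    (X : Fin n → Ω → ℝ) (hXmeas : ∀ i, Measurable (X i))
    (hXindep : iIndepFun X P)
    (hXmoment : ∀ i, Integrable (fun ω => |X i ω| ^ ((N : ℝ) + max (α + p) 2)) P)
    (hXmean : ∀ i, ∫ ω, X i ω ∂P = 0)
    (hXvar : ∀ i, 0 < variance (X i) P) :
    (∀ i, ∃! ν : Measure ℝ, IsProbabilityMeasure ν ∧ IsZeroBias (P.map (X i)) ν) ∧
    ∀ D : (ℝ → ℝ) → ℝ → ℝ, IsDerivativeConvention D →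
    ∀ Xs : Fin n → Ω → ℝ, (∀ i, Measurable (Xs i)) →
      (∀ i, IsZeroBias (P.map (X i)) (P.map (Xs i))) →
      (∀ i, IndepFun (Xs i) (sumWithout X i) P) →
      MainTermWellDefined D P X Xs N h ∧
      ErrorTermWellDefined D P X Xs N h ∧
      Integrable (fun ω => h (sumW X ω)) P ∧
      ∫ ω, h (sumW X ω) ∂P = mainTerm D P X Xs N h + errorTerm D P X Xs N h := by
  have hN : (0 : ℝ) ≤ N := N.cast_nonneg
  set M : ℝ := (N : ℝ) + max (α + p) 2 with hMdef
  have hM2 : (N : ℝ) + 2 ≤ M := by rw [hMdef]; gcongr; exact le_max_right _ _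
  have hMq : (N : ℝ) + (α + p) ≤ M := by rw [hMdef]; gcongr; exact le_max_left _ _
  have hX (i) : MemLp (X i) (ENNReal.ofReal M) P :=
    memLp_of_integrable_abs_rpow (hXmeas i) (by linarith) (hXmoment i)
  refine ⟨fun i => existsUnique_zeroBias_map (hXmeas i) (by linarith) (hX i) (hXmean i) (hXvar i),
    fun D hD Xs hXsmeas hzb hXsindep => ?_⟩
  exact (hh.finiteOrderClass hα0 hp).expansion hD (by positivity) hn hXmeas hXindep hX hXvar
    hXsmeas (fun i => memLp_of_isZeroBias (hXmeas i) (hXsmeas i) (by linarith) (hX i) (hXmean i)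
      (hXvar i) (hzb i)) hzb hXsindep hMq hM2
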